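/- Setting. Let $Z\sim\mathcal N(0,1)$ and, for $K>0$, put $p_{r,K}=\mathbb P[|Z|\le K]$ and $p_{u,K}=\mathbb P[|Z|\ge K]$. For $N,M\in\mathbb N$ let $X$ be an $M\times N$ random matrix with i.i.d. $\mathcal N(0,1/N)$ entries. Let $\mathcal E^r(N,M)$ be the event that some $w\in\{\pm1\}^N$ satisfies $\bigl|\sum_{i=1}^N X_{\mu i}w_i\bigr|\le K$ for all $\mu=1,\dots,M$ (rectangle binary perceptron), and let $\mathcal E^u(N,M)$ be the event that some $w\in\{\pm1\}^N$ satisfies $\bigl|\sum_{i=1}^N X_{\mu i}w_i\bigr|\ge K$ for all $\mu$ ($u$-function binary perceptron). For $\beta\in[0,1]$ let $Z,Z'$ be independent standard Gaussians, $Z_1=\sqrt\beta\,Z+\sqrt{1-\beta}\,Z'$, $Z_\beta=\sqrt\beta\,Z-\sqrt{1-\beta}\,Z'$, and set $$q_{r,K}(\beta)=\mathbb P[|Z_1|\le K,\ |Z_\beta|\le K],\qquad q_{u,K}(\beta)=\mathbb P[|Z_1|\ge K,\ |Z_\beta|\ge K].$$ For $t\in\{r,u\}$ and $\alpha>0$ let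 $F_{t,K,\alpha}(\beta)=-\beta\log\beta-(1-\beta)\log(1-\beta)+\alpha\log q_{t,K}(\beta)$. Say that the numerical hypothesis $\mathrm{H}_t(K,\alpha)$ holds if the following implication is true: if $F_{t,K,\alpha}''(1/2)<0$, then there is exactly one $\beta\in(1/2,1)$ with $F_{t,K,\alpha}'(\beta)=0$. Let $K^*\simeq0.817$ be the solution in $(0,\infty)$ of $$\pi\,p_{u,K}^2\,e^{K^2}\log p_{u,K}=-2\log(2)\,K^2 .$$ Proposition. Let $K>0$ and $\alpha>0$. 1. If $\mathrm{H}_r(K,\alpha)$ holds and $\alpha<\dfrac{-\log 2}{\log p_{r,K}}$, then $\displaystyle\liminf_{N\to\infty}\mathbb P\bigl[\mathcal E^r(N,\lfloor\alpha N\rfloor)\bigr]>0$. 2. If $\mathrm{H}_u(K,\alpha)$ holds, $K<K^*$ and $\alpha<\dfrac{-\log 2}{\log p_{u,K}}$, then $\displaystyle\liminf_{N\to\infty}\mathbb P\bigl[\mathcal E^u(N,\lfloor\alpha N\rfloor)\bigr]>0$. -/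

import Mathlib

open MeasureTheory ProbabilityTheory Filter
open scoped NNReal ENNReal

namespace BinaryPerceptron

noncomputable section

/-- The rectangle activation function, the indicator of `|z| ≤ K`. -/
def rectActivation (K : ℝ) : ℝ → ℝ := Set.indicator {z | |z| ≤ K} 1

/-- The u-function activation function, the indicator of `K ≤ |z|`. -/
def uActivation (K : ℝ) : ℝ → ℝ := Set.indicator {z | K ≤ |z|} 1

/-- The law of the `M × N` pattern matrix: i.i.d. centred Gaussian entries of variance `1 / N`. -/
def patternLaw (M N : ℕ) : Measure (Fin M → Fin N → ℝ) :=
  Measure.pi fun _ => Measure.pi fun _ => gaussianReal 0 (1 / (N : ℝ≥0))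

/-- The binary weight vectors, `{-1, 1} ^ N`. -/
def weights (N : ℕ) : Finset (Fin N → ℝ) := Fintype.piFinset fun _ => {-1, 1}

/-- The partition function for the activation `φ`: the sum over all binary weight vectors `w` of
the product over the rows `μ` of `φ (∑ i, X μ i * w i)`. -/
def partitionFunction {M N : ℕ} (φ : ℝ → ℝ) (X : Fin M → Fin N → ℝ) : ℝ :=
  ∑ w ∈ weights N, ∏ μ : Fin M, φ (∑ i : Fin N, X μ i * w i)

/-- The event that the rectangle perceptron with `M` patterns in dimension `N` has a solution. -/
def rectEvent (K : ℝ) (N M : ℕ) : Set (Fin M → Fin N → ℝ) :=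
  {X | 1 ≤ partitionFunction (rectActivation K) X}

/-- The event that the u-function perceptron with `M` patterns in dimension `N` has a solution. -/
def uEvent (K : ℝ) (N M : ℕ) : Set (Fin M → Fin N → ℝ) :=
  {X | 1 ≤ partitionFunction (uActivation K) X}

/-- `P(|Z| ≤ K)` for a standard Gaussian `Z`. -/
def pRect (K : ℝ) : ℝ := (gaussianReal 0 1).real {z | |z| ≤ K}

/-- `P(|Z| ≥ K)` for a standard Gaussian `Z`. -/
def pU (K : ℝ) : ℝ := (gaussianReal 0 1).real {z | K ≤ |z|}

/-- First coordinate of the coupling: `√β Z + √(1 - β) Z'`. -/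
def couplePlus (β : ℝ) (z : ℝ × ℝ) : ℝ := √β * z.1 + √(1 - β) * z.2

/-- Second coordinate of the coupling: `√β Z - √(1 - β) Z'`. -/
def coupleMinus (β : ℝ) (z : ℝ × ℝ) : ℝ := √β * z.1 - √(1 - β) * z.2

/-- Probability that both coupled Gaussians are at most `K` in absolute value, for `β ∈ [0, 1]`. -/
def qRect (K β : ℝ) : ℝ :=
  ((gaussianReal 0 1).prod (gaussianReal 0 1)).real
    {z | |couplePlus β z| ≤ K ∧ |coupleMinus β z| ≤ K}

/-- Probability that both coupled Gaussians are at least `K` in absolute value, for `β ∈ [0, 1]`. -/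
def qU (K β : ℝ) : ℝ :=
  ((gaussianReal 0 1).prod (gaussianReal 0 1)).real
    {z | K ≤ |couplePlus β z| ∧ K ≤ |coupleMinus β z|}

/-- `F(β) = H(β) + α log q(β)` for the rectangle function, `H` the Shannon entropy (in nats). -/
def FRect (K α β : ℝ) : ℝ := Real.binEntropy β + α * Real.log (qRect K β)

/-- `F(β) = H(β) + α log q(β)` for the u-function, `H` the Shannon entropy (in nats). -/
def FU (K α β : ℝ) : ℝ := Real.binEntropy β + α * Real.log (qU K β)

/-- The numerical hypothesis on one function `F` on the unit interval: if `F''(1/2) < 0`, then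
`F'` has exactly one zero in `(1/2, 1)`. -/
def NumericalHypothesis (F : ℝ → ℝ) : Prop :=
  deriv (deriv F) (1 / 2) < 0 → ∃! β : ℝ, β ∈ Set.Ioo (1 / 2) 1 ∧ deriv F β = 0

/-- `Kstar` is a positive solution of `π p_u(K)² exp(K²) log p_u(K) = -2 log(2) K²`. -/
def IsKStar (Kstar : ℝ) : Prop :=
  0 < Kstar ∧
    Real.pi * pU Kstar ^ 2 * Real.exp (Kstar ^ 2) * Real.log (pU Kstar) =
      -2 * Real.log 2 * Kstar ^ 2

end

end BinaryPerceptron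

/-!
# Positive probability of solutions for symmetric binary perceptrons

The proof is the second moment method. Write `S` for the set where the activation equals `1`, `p` for
its Gaussian measure and `q β` for the probability that two standard Gaussians of correlation
`2 β - 1` both lie in `S`. The partition function has mean `2 ^ N p ^ M` and second moment
`2 ^ N ∑ l, N.choose l * q (l / N) ^ M` (`sq_firstMoment_le`), so by Paley–Zygmund it is enough to
bound the sum by a constant times `2 ^ N p ^ (2 M)`.

This is Laplace's method (`exists_sum_choose_mul_pow_le`): the exponent is `N F(l / N)` with
`F β = binEntropy β + α log (q β)`, and the bound holds if `F` has its strict global maximum at `1/2`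
and `F''(1/2) < 0`. Near `1/2` the sum is compared with a Gaussian exponential moment of a binomial
variable (`sum_choose_exp_sq_le`), elsewhere with entropy bounds.

Polar coordinates turn `q` into an integral over an angular interval (`qRect_eq_integral`), hence
`q' β = (exp (-K² / (2 β)) - exp (-K² / (2 (1 - β)))) / (π √(β (1 - β)))`, for both activations. In
particular `F''(1/2) = -4 + 8 α K² exp (-K²) / (π p²)`. Below the first moment threshold for `α` this
is negative as soon as `2 log 2 K² ≤ π p² exp (K²) (-log p)`. For the u-function this holds for
`K < Kstar` because the quotient of the two sides is monotone (`uThreshold`). For the rectangle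
function it holds for every `K`, with a margin of less than two percent near `K = 1.37`
(`rectThreshold`).
With `F''(1/2) < 0` at hand, the numerical hypothesis leaves only `β = 1/2` and `β = 1` as candidates
for the maximum on `[1/2, 1]` (`lt_at_half_of_numericalHypothesis`), and `F 1 < F (1/2)` is the first
moment condition.
-/

namespace BinaryPerceptron

/-! ### The first and second moments of the partition function -/

/-- Grouping the weight vectors by the number of coordinates on which they agree with a fixed `w`:
exactly `N.choose l` of them agree with `w` on `l` coordinates. -/
lemma sum_weights_agree {N : ℕ} {w : Fin N → ℝ} (hw : w ∈ weights N) (f : ℕ → ℝ) :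
    ∑ w' ∈ weights N, f (Finset.univ.filter fun i => w i = w' i).card =
      ∑ l ∈ Finset.range (N + 1), N.choose l * f l := by
  have key := Finset.sum_powerset_apply_card f (x := (Finset.univ : Finset (Fin N)))
  simp only [Finset.card_univ, Fintype.card_fin, nsmul_eq_mul] at key
  rw [← key]
  have hw' : ∀ i, w i = -1 ∨ w i = 1 := by
    intro i; simpa [weights] using (Fintype.mem_piFinset.1 hw) i
  have hne : ∀ i, w i ≠ -w i := by
    intro i; rcases hw' i with h | h <;> rw [h] <;> norm_num
  refine Finset.sum_nbij' (fun w' => Finset.univ.filter fun i => w i = w' i)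
    (fun A i => if i ∈ A then w i else -w i) ?_ ?_ ?_ ?_ ?_
  · intro w' _; simp
  · intro A _
    refine Fintype.mem_piFinset.2 fun i => ?_
    rcases hw' i with h | h <;> by_cases hA : i ∈ A <;> simp [hA, h]
  · intro w' hm
    have hm' : ∀ i, w' i = -1 ∨ w' i = 1 := by
      intro i; simpa [weights] using (Fintype.mem_piFinset.1 hm) i
    funext i
    by_cases h : w i = w' i
    · simp [h]
    · rcases hw' i with h1 | h1 <;> rcases hm' i with h2 | h2 <;> simp_all
  · intro A _
    ext i
    by_cases hA : i ∈ A <;> simp [hA, hne i]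
  · intro w' _; rfl

lemma card_weights (N : ℕ) : ((weights N).card : ℝ) = 2 ^ N := by
  have : ({-1, 1} : Finset ℝ).card = 2 := by
    rw [Finset.card_pair]; norm_num
  simp [weights, Fintype.card_piFinset, this]

/-- The Paley–Zygmund inequality at level zero, for a variable without values in `(-∞, 0) ∪ (0, 1)`.
The quadratic `t ↦ ∫ (t Y - 1_{1 ≤ Y})²` is nonnegative, so its discriminant is not positive. -/
lemma sq_integral_le_mul_measureReal {Ω : Type*} [MeasurableSpace Ω] {μ : Measure Ω}
    [IsProbabilityMeasure μ] {Y : Ω → ℝ} (hY : MemLp Y 2 μ) (hm : Measurable Y)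
    (h0 : ∀ ω, Y ω < 1 → Y ω = 0) :
    (∫ ω, Y ω ∂μ) ^ 2 ≤ (∫ ω, Y ω ^ 2 ∂μ) * μ.real {ω | 1 ≤ Y ω} := by
  set E : Set Ω := {ω | 1 ≤ Y ω}
  have hE : MeasurableSet E := measurableSet_le measurable_const hm
  have hi1 : Integrable Y μ := hY.integrable one_le_two
  have hi2 : Integrable (fun ω => Y ω ^ 2) μ := hY.integrable_sq
  have hi3 : Integrable (E.indicator (1 : Ω → ℝ)) μ :=
    (integrable_const (1 : ℝ)).indicator hE
  have hquad : ∀ t : ℝ, 0 ≤ (∫ ω, Y ω ^ 2 ∂μ) * (t * t) + (-2 * ∫ ω, Y ω ∂μ) * t + μ.real E := by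
    intro t
    have h1 : ∫ ω, (t ^ 2 * Y ω ^ 2 + (-2 * t) * Y ω + E.indicator (1 : Ω → ℝ) ω) ∂μ =
        t ^ 2 * (∫ ω, Y ω ^ 2 ∂μ) + (-2 * t) * (∫ ω, Y ω ∂μ) + μ.real E := by
      have hi12 : Integrable (fun ω => t ^ 2 * Y ω ^ 2 + (-2 * t) * Y ω) μ :=
        (hi2.const_mul _).add (hi1.const_mul _)
      rw [integral_add hi12 hi3,
        integral_add (hi2.const_mul _) (hi1.const_mul _), integral_const_mul, integral_const_mul,
        integral_indicator_one hE]
    have h2 : 0 ≤ ∫ ω, (t ^ 2 * Y ω ^ 2 + (-2 * t) * Y ω + E.indicator (1 : Ω → ℝ) ω) ∂μ := by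
      refine integral_nonneg fun ω => ?_
      by_cases h : ω ∈ E
      · simp only [Set.indicator_of_mem h, Pi.one_apply, Pi.zero_apply]
        nlinarith [sq_nonneg (t * Y ω - 1)]
      · have : Y ω = 0 := h0 ω (not_le.1 h)
        simp [h, this]
    rw [h1] at h2
    linarith
  have := discrim_le_zero hquad
  rw [discrim] at this
  nlinarith

/-- Probability that both Gaussians of the coupling with parameter `β` lie in `S`. The functions
`qRect K` and `qU K` are the cases `S = {z | |z| ≤ K}` and `S = {z | K ≤ |z|}`, definitionally. -/
noncomputable def pairProb (S : Set ℝ) (β : ℝ) : ℝ :=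
  ((gaussianReal 0 1).prod (gaussianReal 0 1)).real
    {z | couplePlus β z ∈ S ∧ coupleMinus β z ∈ S}

@[fun_prop]
lemma measurable_couplePlus (β : ℝ) : Measurable (couplePlus β) := by
  unfold couplePlus; fun_prop

@[fun_prop]
lemma measurable_coupleMinus (β : ℝ) : Measurable (coupleMinus β) := by
  unfold coupleMinus; fun_prop

lemma integral_exp_linear_gaussian {N : ℕ} (v : ℝ≥0) (c : Fin N → ℝ) :
    ∫ x, Complex.exp ((∑ i, x i * c i : ℝ) * Complex.I)
        ∂(Measure.pi fun _ : Fin N => gaussianReal 0 v) =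
      Complex.exp (-(v * ∑ i, c i ^ 2 : ℝ) / 2) := by
  have h : ∀ x : Fin N → ℝ, Complex.exp ((∑ i, x i * c i : ℝ) * Complex.I) =
      ∏ i, Complex.exp (c i * x i * Complex.I) := by
    intro x
    rw [← Complex.exp_sum]
    congr 1
    push_cast
    rw [Finset.sum_mul]
    exact Finset.sum_congr rfl fun i _ => by ring
  simp_rw [h]
  rw [integral_fintype_prod_eq_prod (fun i (y : ℝ) => Complex.exp (c i * y * Complex.I))]
  have h2 : ∀ i, ∫ y, Complex.exp (c i * y * Complex.I) ∂(gaussianReal 0 v) =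
      Complex.exp (-(v * c i ^ 2 : ℝ) / 2) := by
    intro i
    rw [← charFun_apply_real, charFun_gaussianReal]
    congr 1
    push_cast
    ring
  simp_rw [h2]
  rw [← Complex.exp_sum]
  congr 1
  push_cast
  rw [← Finset.sum_div, Finset.mul_sum, ← Finset.sum_neg_distrib]

lemma sq_sum_weights {N : ℕ} (hN : N ≠ 0) {w w' : Fin N → ℝ} (hw : w ∈ weights N)
    (hw' : w' ∈ weights N) (a b : ℝ) {β : ℝ}
    (hβ : β = ((Finset.univ.filter fun i => w i = w' i).card : ℝ) / N) :
    (1 / (N : ℝ)) * ∑ i, (a * w i + b * w' i) ^ 2 = β * (a + b) ^ 2 + (1 - β) * (a - b) ^ 2 := by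
  have h1 : ∀ i, w i = -1 ∨ w i = 1 := by
    intro i; simpa [weights] using (Fintype.mem_piFinset.1 hw) i
  have h2 : ∀ i, w' i = -1 ∨ w' i = 1 := by
    intro i; simpa [weights] using (Fintype.mem_piFinset.1 hw') i
  have h : ∀ i, (a * w i + b * w' i) ^ 2 =
      (a - b) ^ 2 + (if w i = w' i then 1 else 0) * ((a + b) ^ 2 - (a - b) ^ 2) := by
    intro i
    rcases h1 i with h | h <;> rcases h2 i with h' | h' <;> rw [h, h'] <;> norm_num <;> ring
  simp_rw [h]
  rw [Finset.sum_add_distrib, ← Finset.sum_mul, Finset.sum_boole, hβ]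
  have : (N : ℝ) ≠ 0 := by exact_mod_cast hN
  simp only [Finset.sum_const, Finset.card_univ, Fintype.card_fin, nsmul_eq_mul]
  field_simp
  ring

/-- If `w` and `w'` agree on a proportion `β` of the coordinates, then the products of one pattern
with `w` and `w'` have the law of the coupled pair: both laws have the same characteristic function,
by `sq_sum_weights`. -/
lemma map_row_products_eq_couple {N : ℕ} (hN : N ≠ 0) {w w' : Fin N → ℝ} (hw : w ∈ weights N)
    (hw' : w' ∈ weights N) {β : ℝ}
    (hβ : β = ((Finset.univ.filter fun i => w i = w' i).card : ℝ) / N) :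
    (Measure.pi fun _ : Fin N => gaussianReal 0 (1 / (N : ℝ≥0))).map
        (fun x => (∑ i, x i * w i, ∑ i, x i * w' i)) =
      ((gaussianReal 0 1).prod (gaussianReal 0 1)).map
        (fun z => (couplePlus β z, coupleMinus β z)) := by
  have hN0 : (0 : ℝ) < N := by exact_mod_cast Nat.pos_of_ne_zero hN
  have hβ0 : 0 ≤ β := by rw [hβ]; positivity
  have hβ1 : β ≤ 1 := by
    rw [hβ, div_le_one hN0]
    exact_mod_cast (Finset.card_le_univ _).trans (by simp)
  have hm1 : Measurable fun x : Fin N → ℝ => (∑ i, x i * w i, ∑ i, x i * w' i) := by fun_prop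
  have hm2 : Measurable fun z : ℝ × ℝ => (couplePlus β z, coupleMinus β z) := by fun_prop
  have := Measure.isProbabilityMeasure_map (μ := Measure.pi fun _ : Fin N =>
    gaussianReal 0 (1 / (N : ℝ≥0))) hm1.aemeasurable
  have := Measure.isProbabilityMeasure_map
    (μ := (gaussianReal 0 1).prod (gaussianReal 0 1)) hm2.aemeasurable
  refine Measure.ext_of_charFunDual ?_
  funext L
  obtain ⟨a, ha⟩ : ∃ a, a = L (1, 0) := ⟨_, rfl⟩
  obtain ⟨b, hb⟩ : ∃ b, b = L (0, 1) := ⟨_, rfl⟩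
  have hL : ∀ x y : ℝ, L (x, y) = a * x + b * y := by
    intro x y
    have : ((x, y) : ℝ × ℝ) = x • (1, 0) + y • (0, 1) := by simp
    rw [this, map_add, map_smul, map_smul, ha, hb, smul_eq_mul, smul_eq_mul]
    ring
  have hLm : Measurable fun p : ℝ × ℝ => Complex.exp (L p * Complex.I) := by fun_prop
  rw [charFunDual_apply, charFunDual_apply,
    integral_map hm1.aemeasurable hLm.aestronglyMeasurable,
    integral_map hm2.aemeasurable hLm.aestronglyMeasurable]
  have e1 : ∀ x : Fin N → ℝ, L (∑ i, x i * w i, ∑ i, x i * w' i) =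
      ∑ i, x i * (a * w i + b * w' i) := by
    intro x
    rw [hL, Finset.mul_sum, Finset.mul_sum, ← Finset.sum_add_distrib]
    exact Finset.sum_congr rfl fun i _ => by ring
  simp_rw [e1]
  rw [integral_exp_linear_gaussian]
  have e2 : ∀ z : ℝ × ℝ, Complex.exp (L (couplePlus β z, coupleMinus β z) * Complex.I) =
      Complex.exp ((√β * (a + b) : ℝ) * z.1 * Complex.I) *
        Complex.exp ((√(1 - β) * (a - b) : ℝ) * z.2 * Complex.I) := by
    intro z
    rw [hL, couplePlus, coupleMinus, ← Complex.exp_add]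
    congr 1
    push_cast
    ring
  simp_rw [e2]
  rw [integral_prod_mul (fun x : ℝ => Complex.exp ((√β * (a + b) : ℝ) * x * Complex.I))
    (fun y : ℝ => Complex.exp ((√(1 - β) * (a - b) : ℝ) * y * Complex.I)),
    ← charFun_apply_real, ← charFun_apply_real, charFun_gaussianReal, charFun_gaussianReal,
    ← Complex.exp_add]
  congr 1
  have := sq_sum_weights hN hw hw' a b hβ
  have hs1 := Real.sq_sqrt hβ0
  have hs2 := Real.sq_sqrt (sub_nonneg.2 hβ1)
  have h3 : (√β * (a + b)) ^ 2 + (√(1 - β) * (a - b)) ^ 2 =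
      (1 / (N : ℝ)) * ∑ i, (a * w i + b * w' i) ^ 2 := by
    rw [this, mul_pow, mul_pow, hs1, hs2]
  have h4 : (((1 / (N : ℝ≥0) : ℝ≥0) : ℝ)) = 1 / (N : ℝ) := by push_cast; rfl
  rw [h4, ← h3]
  push_cast
  ring

lemma integral_row_pair {N : ℕ} (hN : N ≠ 0) {w w' : Fin N → ℝ} (hw : w ∈ weights N)
    (hw' : w' ∈ weights N) {S : Set ℝ} (hS : MeasurableSet S) :
    ∫ x, S.indicator (1 : ℝ → ℝ) (∑ i, x i * w i) * S.indicator (1 : ℝ → ℝ) (∑ i, x i * w' i)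
        ∂(Measure.pi fun _ : Fin N => gaussianReal 0 (1 / (N : ℝ≥0))) =
      pairProb S (((Finset.univ.filter fun i => w i = w' i).card : ℝ) / N) := by
  set β := ((Finset.univ.filter fun i => w i = w' i).card : ℝ) / N with hβ
  have hm1 : Measurable fun x : Fin N → ℝ => (∑ i, x i * w i, ∑ i, x i * w' i) := by fun_prop
  have hm2 : Measurable fun z : ℝ × ℝ => (couplePlus β z, coupleMinus β z) := by fun_prop
  have hSS : MeasurableSet (S ×ˢ S) := hS.prod hS
  have h1 : ∀ x : Fin N → ℝ,
      S.indicator (1 : ℝ → ℝ) (∑ i, x i * w i) * S.indicator (1 : ℝ → ℝ) (∑ i, x i * w' i) =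
      ((fun x : Fin N → ℝ => (∑ i, x i * w i, ∑ i, x i * w' i)) ⁻¹' (S ×ˢ S)).indicator 1 x := by
    intro x
    by_cases h : (∑ i, x i * w i) ∈ S <;> by_cases h' : (∑ i, x i * w' i) ∈ S <;>
      simp [Set.indicator, h, h']
  simp_rw [h1]
  rw [integral_indicator_one (hm1 hSS), measureReal_def, ← Measure.map_apply hm1 hSS,
    map_row_products_eq_couple hN hw hw' hβ, Measure.map_apply hm2 hSS]
  rfl

lemma pairProb_one (S : Set ℝ) : pairProb S 1 = (gaussianReal 0 1).real S := by
  have : {z : ℝ × ℝ | couplePlus 1 z ∈ S ∧ coupleMinus 1 z ∈ S} = S ×ˢ Set.univ := by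
    ext z; simp [couplePlus, coupleMinus]
  rw [pairProb, this, measureReal_def, Measure.prod_prod]
  simp [measureReal_def]

lemma integral_row_single {N : ℕ} (hN : N ≠ 0) {w : Fin N → ℝ} (hw : w ∈ weights N)
    {S : Set ℝ} (hS : MeasurableSet S) :
    ∫ x, S.indicator (1 : ℝ → ℝ) (∑ i, x i * w i)
        ∂(Measure.pi fun _ : Fin N => gaussianReal 0 (1 / (N : ℝ≥0))) =
      (gaussianReal 0 1).real S := by
  have h := integral_row_pair hN hw hw hS
  have hN0 : (N : ℝ) ≠ 0 := by exact_mod_cast hN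
  simp only [Finset.filter_true, Finset.card_univ, Fintype.card_fin, div_self hN0,
    pairProb_one] at h
  rw [← h]
  congr 1
  funext x
  by_cases h : (∑ i, x i * w i) ∈ S <;> simp [h]

/-- The second moment inequality. The first moment of the partition function is
`2 ^ N * P(S) ^ M`, and its second moment is a sum over pairs of weight vectors, grouped by the
number `l` of coordinates on which they agree. -/
lemma sq_firstMoment_le {N : ℕ} (hN : N ≠ 0) (M : ℕ) {S : Set ℝ} (hS : MeasurableSet S) :
    (2 ^ N * (gaussianReal 0 1).real S ^ M) ^ 2 ≤
      (2 ^ N * ∑ l ∈ Finset.range (N + 1), N.choose l * pairProb S ((l : ℝ) / N) ^ M) *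
      (patternLaw M N).real {X | 1 ≤ partitionFunction (S.indicator 1) X} := by
  have : IsProbabilityMeasure (patternLaw M N) := by unfold patternLaw; infer_instance
  set φ : ℝ → ℝ := S.indicator 1 with hφ
  have hφm : Measurable φ := measurable_one.indicator hS
  have hφ01 : ∀ x, φ x = 0 ∨ φ x = 1 := by
    intro x; by_cases h : x ∈ S <;> simp [hφ, h]
  set T : (Fin N → ℝ) → (Fin M → Fin N → ℝ) → ℝ :=
    fun w X => ∏ μ : Fin M, φ (∑ i : Fin N, X μ i * w i) with hT
  have hTm : ∀ w, Measurable (T w) := by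
    intro w
    refine Finset.measurable_prod _ fun μ _ => hφm.comp ?_
    fun_prop
  have hT01 : ∀ w X, T w X = 0 ∨ T w X = 1 := by
    intro w X
    by_cases h : ∃ μ, φ (∑ i : Fin N, X μ i * w i) = 0
    · obtain ⟨μ, hμ⟩ := h
      exact Or.inl (Finset.prod_eq_zero (Finset.mem_univ μ) hμ)
    · push Not at h
      exact Or.inr (Finset.prod_eq_one fun μ _ => (hφ01 _).resolve_left (h μ))
  have hTn : ∀ w X, ‖T w X‖ ≤ 1 := by
    intro w X; rcases hT01 w X with h | h <;> simp [h]
  have hTp : ∀ w, MemLp (T w) 2 (patternLaw M N) := fun w =>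
    MemLp.of_bound (hTm w).aestronglyMeasurable 1 (ae_of_all _ (hTn w))
  have hY : (fun X => partitionFunction φ X) = fun X => ∑ w ∈ weights N, T w X := rfl
  have hYp : MemLp (fun X : Fin M → Fin N → ℝ => partitionFunction φ X) 2 (patternLaw M N) := by
    rw [hY]; exact memLp_finsetSum _ fun w _ => hTp w
  have hYm : Measurable (fun X : Fin M → Fin N → ℝ => partitionFunction φ X) := by
    rw [hY]; exact Finset.measurable_sum _ fun w _ => hTm w
  have h0 : ∀ X : Fin M → Fin N → ℝ, partitionFunction φ X < 1 → partitionFunction φ X = 0 := by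
    intro X hX
    refine Finset.sum_eq_zero fun w hw => ?_
    rcases hT01 w X with h | h
    · exact h
    · exfalso
      have : T w X ≤ partitionFunction φ X :=
        Finset.single_le_sum (f := fun w => T w X)
          (fun w _ => by rcases hT01 w X with h | h <;> simp [h]) hw
      linarith
  have key := sq_integral_le_mul_measureReal hYp hYm h0
  have first : ∫ X, partitionFunction φ X ∂(patternLaw M N) =
      2 ^ N * (gaussianReal 0 1).real S ^ M := by
    rw [hY, integral_finsetSum _ fun w _ => (hTp w).integrable one_le_two]
    have : ∀ w ∈ weights N, ∫ X, T w X ∂(patternLaw M N) = (gaussianReal 0 1).real S ^ M := by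
      intro w hw
      rw [hT, patternLaw, integral_fintype_prod_eq_pow (fun x : Fin N → ℝ => φ (∑ i, x i * w i)),
        integral_row_single hN hw hS, Fintype.card_fin]
    rw [Finset.sum_congr rfl this, Finset.sum_const, nsmul_eq_mul, card_weights]
  have second : ∫ X, partitionFunction φ X ^ 2 ∂(patternLaw M N) =
      2 ^ N * ∑ l ∈ Finset.range (N + 1), N.choose l * pairProb S ((l : ℝ) / N) ^ M := by
    have e : ∀ X : Fin M → Fin N → ℝ, partitionFunction φ X ^ 2 =
        ∑ w ∈ weights N, ∑ w' ∈ weights N, T w X * T w' X := by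
      intro X
      rw [sq, partitionFunction, Finset.sum_mul_sum]
    have hint : ∀ w w', Integrable (fun X => T w X * T w' X) (patternLaw M N) := fun w w' =>
      (hTp w).integrable_mul (hTp w')
    simp_rw [e]
    rw [integral_finsetSum _ fun w _ => integrable_finsetSum _ fun w' _ => hint w w']
    have : ∀ w ∈ weights N, ∫ X, ∑ w' ∈ weights N, T w X * T w' X ∂(patternLaw M N) =
        ∑ l ∈ Finset.range (N + 1), N.choose l * pairProb S ((l : ℝ) / N) ^ M := by
      intro w hw
      rw [integral_finsetSum _ fun w' _ => hint w w',
        ← sum_weights_agree hw (fun l => pairProb S ((l : ℝ) / N) ^ M)]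
      refine Finset.sum_congr rfl fun w' hw' => ?_
      simp_rw [hT, ← Finset.prod_mul_distrib]
      rw [patternLaw, integral_fintype_prod_eq_pow
        (fun x : Fin N → ℝ => φ (∑ i, x i * w i) * φ (∑ i, x i * w' i)),
        integral_row_pair hN hw hw' hS, Fintype.card_fin]
    rw [Finset.sum_congr rfl this, Finset.sum_const, nsmul_eq_mul, card_weights]
  rwa [first, second] at key

/-! ### The pair probability at the ends and at the centre -/

lemma integral_exp_pair_gaussian (a b : ℝ) :
    ∫ z : ℝ × ℝ, Complex.exp ((a * z.1 + b * z.2 : ℝ) * Complex.I)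
        ∂((gaussianReal 0 1).prod (gaussianReal 0 1)) =
      Complex.exp (-(a ^ 2 + b ^ 2 : ℝ) / 2) := by
  have e2 : ∀ z : ℝ × ℝ, Complex.exp ((a * z.1 + b * z.2 : ℝ) * Complex.I) =
      Complex.exp (a * z.1 * Complex.I) * Complex.exp (b * z.2 * Complex.I) := by
    intro z
    rw [← Complex.exp_add]
    congr 1
    push_cast
    ring
  simp_rw [e2]
  rw [integral_prod_mul (fun x : ℝ => Complex.exp (a * x * Complex.I))
    (fun y : ℝ => Complex.exp (b * y * Complex.I)),
    ← charFun_apply_real, ← charFun_apply_real, charFun_gaussianReal, charFun_gaussianReal,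
    ← Complex.exp_add]
  congr 1
  push_cast
  ring

lemma map_unit_combination_gaussian {a b : ℝ} (h : a ^ 2 + b ^ 2 = 1) :
    ((gaussianReal 0 1).prod (gaussianReal 0 1)).map (fun z => a * z.1 + b * z.2) =
      gaussianReal 0 1 := by
  have hm : Measurable fun z : ℝ × ℝ => a * z.1 + b * z.2 := by fun_prop
  have := Measure.isProbabilityMeasure_map
    (μ := (gaussianReal 0 1).prod (gaussianReal 0 1)) hm.aemeasurable
  refine Measure.ext_of_charFun ?_
  funext t
  have hg : Measurable fun x : ℝ => Complex.exp (t * x * Complex.I) := by fun_prop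
  rw [charFun_gaussianReal, charFun_apply_real, integral_map hm.aemeasurable
    hg.aestronglyMeasurable]
  have := integral_exp_pair_gaussian (t * a) (t * b)
  have e : ∀ z : ℝ × ℝ, (t : ℂ) * (a * z.1 + b * z.2 : ℝ) = (t * a * z.1 + t * b * z.2 : ℝ) := by
    intro z; push_cast; ring
  simp_rw [e]
  rw [this]
  congr 1
  rw [show (t * a) ^ 2 + (t * b) ^ 2 = t ^ 2 by rw [← mul_one (t ^ 2), ← h]; ring]
  push_cast
  ring

/-- At `β = 1 / 2` the coupling is a rotation, which preserves the standard Gaussian of the plane. -/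
lemma map_couple_half :
    ((gaussianReal 0 1).prod (gaussianReal 0 1)).map
        (fun z => (couplePlus (1 / 2) z, coupleMinus (1 / 2) z)) =
      (gaussianReal 0 1).prod (gaussianReal 0 1) := by
  have hm : Measurable fun z : ℝ × ℝ => (couplePlus (1 / 2) z, coupleMinus (1 / 2) z) := by
    fun_prop
  have := Measure.isProbabilityMeasure_map
    (μ := (gaussianReal 0 1).prod (gaussianReal 0 1)) hm.aemeasurable
  refine Measure.ext_of_charFunDual ?_
  funext L
  obtain ⟨a, ha⟩ : ∃ a, a = L (1, 0) := ⟨_, rfl⟩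
  obtain ⟨b, hb⟩ : ∃ b, b = L (0, 1) := ⟨_, rfl⟩
  have hL : ∀ z : ℝ × ℝ, L z = a * z.1 + b * z.2 := by
    intro z
    have : z = z.1 • ((1, 0) : ℝ × ℝ) + z.2 • ((0, 1) : ℝ × ℝ) := by simp
    conv_lhs => rw [this]
    rw [map_add, map_smul, map_smul, ha, hb, smul_eq_mul, smul_eq_mul]
    ring
  have hLm : Measurable fun p : ℝ × ℝ => Complex.exp (L p * Complex.I) := by fun_prop
  rw [charFunDual_apply, charFunDual_apply, integral_map hm.aemeasurable hLm.aestronglyMeasurable]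
  simp_rw [hL]
  rw [integral_exp_pair_gaussian]
  have e : ∀ z : ℝ × ℝ, a * couplePlus (1 / 2) z + b * coupleMinus (1 / 2) z =
      (√(1 / 2) * (a + b)) * z.1 + (√(1 / 2) * (a - b)) * z.2 := by
    intro z
    rw [couplePlus, coupleMinus, show (1 : ℝ) - 1 / 2 = 1 / 2 by norm_num]
    ring
  simp_rw [e]
  rw [integral_exp_pair_gaussian]
  have hs : √(1 / 2 : ℝ) ^ 2 = 1 / 2 := Real.sq_sqrt (by norm_num)
  rw [mul_pow, mul_pow, hs]
  congr 1
  push_cast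
  ring

lemma pairProb_half {S : Set ℝ} (hS : MeasurableSet S) :
    pairProb S (1 / 2) = (gaussianReal 0 1).real S ^ 2 := by
  have hm : Measurable fun z : ℝ × ℝ => (couplePlus (1 / 2) z, coupleMinus (1 / 2) z) := by
    fun_prop
  have h : {z | couplePlus (1 / 2) z ∈ S ∧ coupleMinus (1 / 2) z ∈ S} =
      (fun z : ℝ × ℝ => (couplePlus (1 / 2) z, coupleMinus (1 / 2) z)) ⁻¹' (S ×ˢ S) := rfl
  rw [pairProb, h, measureReal_def, ← Measure.map_apply hm (hS.prod hS), map_couple_half,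
    Measure.prod_prod, ENNReal.toReal_mul, sq]
  rfl

/-- The exchange `β ↔ 1 - β` amounts to the exchange of `Z` and `Z'`, up to a sign. -/
lemma pairProb_one_sub {S : Set ℝ} (hS : MeasurableSet S) (hneg : ∀ x, -x ∈ S ↔ x ∈ S) (β : ℝ) :
    pairProb S (1 - β) = pairProb S β := by
  have hms : MeasurableSet {z | couplePlus (1 - β) z ∈ S ∧ coupleMinus (1 - β) z ∈ S} :=
    (measurable_couplePlus _ hS).inter (measurable_coupleMinus _ hS)
  rw [pairProb, measureReal_def, ← Measure.prod_swap, Measure.map_apply measurable_swap hms]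
  congr 2
  ext z
  have h1 : couplePlus (1 - β) z.swap = couplePlus β z := by
    simp [couplePlus]; ring
  have h2 : coupleMinus (1 - β) z.swap = -coupleMinus β z := by
    simp [coupleMinus]
  simp [h1, h2, hneg]

lemma measureReal_couplePlus {β : ℝ} (h0 : 0 ≤ β) (h1 : β ≤ 1) {S : Set ℝ}
    (hS : MeasurableSet S) :
    ((gaussianReal 0 1).prod (gaussianReal 0 1)).real (couplePlus β ⁻¹' S) =
      (gaussianReal 0 1).real S := by
  have h := map_unit_combination_gaussian (a := √β) (b := √(1 - β))
    (by rw [Real.sq_sqrt h0, Real.sq_sqrt (sub_nonneg.2 h1)]; ring)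
  have h2 := Measure.map_apply (μ := (gaussianReal 0 1).prod (gaussianReal 0 1))
    (f := fun z : ℝ × ℝ => √β * z.1 + √(1 - β) * z.2) (by fun_prop) hS
  rw [h] at h2
  rw [measureReal_def, measureReal_def, h2]
  rfl

lemma measureReal_coupleMinus {β : ℝ} (h0 : 0 ≤ β) (h1 : β ≤ 1) {S : Set ℝ}
    (hS : MeasurableSet S) :
    ((gaussianReal 0 1).prod (gaussianReal 0 1)).real (coupleMinus β ⁻¹' S) =
      (gaussianReal 0 1).real S := by
  have h := map_unit_combination_gaussian (a := √β) (b := -√(1 - β))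
    (by rw [neg_sq, Real.sq_sqrt h0, Real.sq_sqrt (sub_nonneg.2 h1)]; ring)
  have e : (fun z : ℝ × ℝ => √β * z.1 + -√(1 - β) * z.2) = coupleMinus β := by
    funext z; simp [coupleMinus]; ring
  have h2 := Measure.map_apply (μ := (gaussianReal 0 1).prod (gaussianReal 0 1))
    (f := coupleMinus β) (by fun_prop) hS
  rw [← e, h, e] at h2
  rw [measureReal_def, measureReal_def, h2]

lemma gaussian_abs_eq_null (K : ℝ) : gaussianReal 0 1 {z | |z| = K} = 0 := by
  have := nullSingletonClass_gaussianReal (μ := 0) (v := 1) one_ne_zero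
  refine measure_mono_null (t := {K, -K}) ?_ ((Set.toFinite _).measure_zero _)
  intro z hz
  rcases eq_or_eq_neg_of_abs_eq (show |z| = K from hz) with h | h <;> simp [h]

lemma pU_eq (K : ℝ) : pU K = 1 - pRect K := by
  have hm : MeasurableSet {z : ℝ | |z| ≤ K} := measurableSet_le (by fun_prop) (by fun_prop)
  rw [pU, pRect, ← probReal_compl_eq_one_sub hm]
  refine measureReal_congr ?_
  have : ∀ᵐ z ∂(gaussianReal 0 1), |z| ≠ K := by
    rw [ae_iff]; simpa using gaussian_abs_eq_null K
  filter_upwards [this] with z hz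
  refine propext ?_
  change K ≤ |z| ↔ ¬ |z| ≤ K
  rw [not_le]
  exact ⟨fun h => lt_of_le_of_ne h hz.symm, le_of_lt⟩

/-- Inclusion–exclusion; the boundaries `|z| = K` have measure zero. -/
lemma qU_eq {K β : ℝ} (h0 : 0 ≤ β) (h1 : β ≤ 1) : qU K β = 1 - 2 * pRect K + qRect K β := by
  set P := (gaussianReal 0 1).prod (gaussianReal 0 1) with hP
  have hm : MeasurableSet {z : ℝ | |z| ≤ K} := measurableSet_le (by fun_prop) (by fun_prop)
  set A := couplePlus β ⁻¹' {z : ℝ | |z| ≤ K} with hA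
  set B := coupleMinus β ⁻¹' {z : ℝ | |z| ≤ K} with hB
  have hAm : MeasurableSet A := measurable_couplePlus β hm
  have hBm : MeasurableSet B := measurable_coupleMinus β hm
  have hPA : P.real A = pRect K := measureReal_couplePlus h0 h1 hm
  have hPB : P.real B = pRect K := measureReal_coupleMinus h0 h1 hm
  have hnull : MeasurableSet {z : ℝ | |z| = K} := measurableSet_eq_fun (by fun_prop) (by fun_prop)
  have n0 : (gaussianReal 0 1).real {z | |z| = K} = 0 := by
    simp [measureReal_def, gaussian_abs_eq_null]
  have n1 : ∀ᵐ z ∂P, |couplePlus β z| ≠ K := by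
    have := measureReal_couplePlus h0 h1 hnull
    rw [n0, measureReal_eq_zero_iff] at this
    rw [ae_iff]; simpa using this
  have n2 : ∀ᵐ z ∂P, |coupleMinus β z| ≠ K := by
    have := measureReal_coupleMinus h0 h1 hnull
    rw [n0, measureReal_eq_zero_iff] at this
    rw [ae_iff]; simpa using this
  have hU : qU K β = P.real (A ∪ B)ᶜ := by
    rw [qU]
    refine measureReal_congr ?_
    filter_upwards [n1, n2] with z hz1 hz2
    refine propext ?_
    change (K ≤ |couplePlus β z| ∧ K ≤ |coupleMinus β z|) ↔
      ¬ (|couplePlus β z| ≤ K ∨ |coupleMinus β z| ≤ K)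
    rw [not_or, not_le, not_le]
    exact ⟨fun h => ⟨lt_of_le_of_ne h.1 hz1.symm, lt_of_le_of_ne h.2 hz2.symm⟩,
      fun h => ⟨h.1.le, h.2.le⟩⟩
  have hI : qRect K β = P.real (A ∩ B) := rfl
  have := measureReal_union_add_inter (μ := P) (s := A) hBm
  rw [hU, probReal_compl_eq_one_sub (hAm.union hBm), hI]
  linarith

/-! ### The pair probability of the rectangle in polar coordinates -/

lemma lintegral_radial_Ioi {a : ℝ} (ha : 0 ≤ a) :
    ∫⁻ r in Set.Ioi a, ENNReal.ofReal (r * Real.exp (-r ^ 2 / 2)) =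
      ENNReal.ofReal (Real.exp (-a ^ 2 / 2)) := by
  have hd : ∀ x ∈ Set.Ici a, HasDerivAt (fun r : ℝ => -Real.exp (-r ^ 2 / 2))
      (x * Real.exp (-x ^ 2 / 2)) x := by
    intro x _
    have h := ((((hasDerivAt_id x).pow 2).neg.div_const 2).exp).neg
    refine h.congr_deriv ?_
    simp; ring
  have hpos : ∀ x ∈ Set.Ioi a, 0 ≤ x * Real.exp (-x ^ 2 / 2) := fun x hx =>
    mul_nonneg (ha.trans (le_of_lt hx)) (Real.exp_pos _).le
  have hlim : Tendsto (fun r : ℝ => -Real.exp (-r ^ 2 / 2)) atTop (nhds 0) := by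
    rw [← neg_zero]
    refine Tendsto.neg (Real.tendsto_exp_atBot.comp ?_)
    have : Tendsto (fun r : ℝ => r ^ 2 / 2) atTop atTop :=
      (tendsto_pow_atTop two_ne_zero).atTop_div_const two_pos
    refine (tendsto_neg_atTop_atBot.comp this).congr fun r => ?_
    simp [neg_div]
  have hint := integrableOn_Ioi_deriv_of_nonneg' hd hpos hlim
  have hval := integral_Ioi_of_hasDerivAt_of_nonneg' hd hpos hlim
  rw [← ofReal_integral_eq_lintegral_ofReal hint
    ((ae_restrict_iff' measurableSet_Ioi).2 (ae_of_all _ hpos)), hval]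
  congr 1
  ring

lemma prod_gaussian_eq_withDensity :
    (gaussianReal 0 1).prod (gaussianReal 0 1) = (volume : Measure (ℝ × ℝ)).withDensity
      fun z => ENNReal.ofReal ((2 * Real.pi)⁻¹ * Real.exp (-(z.1 ^ 2 + z.2 ^ 2) / 2)) := by
  rw [gaussianReal_of_var_ne_zero 0 one_ne_zero,
    prod_withDensity (measurable_gaussianPDF 0 1) (measurable_gaussianPDF 0 1),
    ← Measure.volume_eq_prod]
  congr 1
  funext z
  rw [gaussianPDF, gaussianPDF, ← ENNReal.ofReal_mul (gaussianPDFReal_nonneg _ _ _)]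
  congr 1
  rw [gaussianPDFReal, gaussianPDFReal]
  have h2 : (√(2 * Real.pi * (1 : ℝ≥0)))⁻¹ * (√(2 * Real.pi * (1 : ℝ≥0)))⁻¹ = (2 * Real.pi)⁻¹ := by
    rw [← mul_inv, Real.mul_self_sqrt (by positivity)]
    simp
  rw [mul_mul_mul_comm, h2, ← Real.exp_add]
  congr 2
  simp
  ring

/-- Polar coordinates for the exterior `A` of a region that is star-shaped about the origin and
leaves it in the direction `ω` at radius `K / h ω`; the radial integral is `exp (-(K / h ω)² / 2)`.
Written with `expNegInvGlue`, which vanishes at `0`, this also covers the unbounded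
directions `h ω = 0`. -/
lemma measure_compl_star_eq_lintegral (K : ℝ) (hK : 0 < K) (h : ℝ → ℝ)
    (hn : ∀ ω, 0 ≤ h ω) {A : Set (ℝ × ℝ)} (hA : MeasurableSet A)
    (hAh : ∀ r ω : ℝ, 0 < r → ((r * Real.cos ω, r * Real.sin ω) ∈ A ↔ K < r * h ω)) :
    ((gaussianReal 0 1).prod (gaussianReal 0 1)) A =
      ∫⁻ ω in Set.Ioo (-Real.pi) Real.pi,
        ENNReal.ofReal ((2 * Real.pi)⁻¹ * expNegInvGlue (2 * h ω ^ 2 / K ^ 2)) := by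
  have hpi := Real.pi_pos
  set ρ : ℝ × ℝ → ℝ≥0∞ :=
    fun z => ENNReal.ofReal ((2 * Real.pi)⁻¹ * Real.exp (-(z.1 ^ 2 + z.2 ^ 2) / 2)) with hρ
  have hρm : Measurable ρ := by rw [hρ]; fun_prop
  rw [prod_gaussian_eq_withDensity, withDensity_apply _ hA, ← lintegral_indicator hA,
    ← lintegral_comp_polarCoord_symm, polarCoord_target, Measure.volume_eq_prod,
    ← Measure.prod_restrict]
  have hfm : Measurable fun p : ℝ × ℝ =>
      ENNReal.ofReal p.1 • A.indicator ρ (polarCoord.symm p) := by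
    refine Measurable.smul (ENNReal.measurable_ofReal.comp measurable_fst) ((hρm.indicator hA).comp ?_)
    exact continuous_polarCoord_symm.measurable
  rw [lintegral_prod_symm' _ hfm]
  refine lintegral_congr fun ω => ?_
  have hin : ∀ r ∈ Set.Ioi (0 : ℝ),
      ENNReal.ofReal r • A.indicator ρ (polarCoord.symm (r, ω)) =
      {r | K < r * h ω}.indicator (fun r => ENNReal.ofReal (2 * Real.pi)⁻¹ *
        ENNReal.ofReal (r * Real.exp (-r ^ 2 / 2))) r := by
    intro r hr
    have hr' : 0 < r := hr
    rw [polarCoord_symm_apply]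
    by_cases hmem : K < r * h ω
    · rw [Set.indicator_of_mem ((hAh r ω hr').2 hmem), Set.indicator_of_mem (by exact hmem),
        smul_eq_mul, hρ, ← ENNReal.ofReal_mul hr'.le, ← ENNReal.ofReal_mul (by positivity)]
      congr 1
      have : (r * Real.cos ω) ^ 2 + (r * Real.sin ω) ^ 2 = r ^ 2 := by
        rw [mul_pow, mul_pow, ← mul_add, Real.cos_sq_add_sin_sq, mul_one]
      simp only [this]
      ring
    · rw [Set.indicator_of_notMem (fun hc => hmem ((hAh r ω hr').1 hc)),
        Set.indicator_of_notMem (by exact hmem), smul_zero]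
  rw [setLIntegral_congr_fun measurableSet_Ioi hin]
  have hmS : MeasurableSet {r : ℝ | K < r * h ω} := measurableSet_lt (by fun_prop) (by fun_prop)
  rw [setLIntegral_indicator hmS, ENNReal.ofReal_mul (by positivity)]
  rcases (hn ω).eq_or_lt with h0 | h0
  · have : {r : ℝ | K < r * h ω} ∩ Set.Ioi 0 = ∅ := by
      ext r; simp [← h0, hK.le]
    rw [this, ← h0]
    simp [expNegInvGlue.zero]
  · have : {r : ℝ | K < r * h ω} ∩ Set.Ioi 0 = Set.Ioi (K / h ω) := by
      ext r
      simp only [Set.mem_inter_iff, Set.mem_ofPred_eq, Set.mem_Ioi, div_lt_iff₀ h0]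
      exact ⟨fun h => h.1, fun h => ⟨h, pos_of_mul_pos_left (hK.trans h) h0.le⟩⟩
    rw [this, lintegral_const_mul _ (by fun_prop), lintegral_radial_Ioi (by positivity)]
    have hpos : 0 < 2 * h ω ^ 2 / K ^ 2 := by positivity
    rw [expNegInvGlue, if_neg (not_le.2 hpos)]
    congr 3
    field_simp

lemma continuous_expNegInvGlue : Continuous expNegInvGlue :=
  (expNegInvGlue.contDiff (n := 0)).continuous

/-- A function on the circle with the symmetries of the coordinate axes is integrated over one
quadrant. -/
lemma integral_fold (f : ℝ → ℝ) (hf : Continuous f) (h1 : ∀ x, f (-x) = f x)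
    (h2 : ∀ x, f (Real.pi - x) = f x) :
    ∫ x in (-Real.pi)..Real.pi, f x = 4 * ∫ x in (0 : ℝ)..(Real.pi / 2), f x := by
  have hi : ∀ a b, IntervalIntegrable f volume a b := fun a b => hf.intervalIntegrable a b
  have e1 : ∫ x in (-Real.pi)..0, f x = ∫ x in (0 : ℝ)..Real.pi, f x := by
    have := intervalIntegral.integral_comp_neg (a := 0) (b := Real.pi) f
    simp only [h1, neg_zero] at this
    exact this.symm
  have e2 : ∫ x in (Real.pi / 2)..Real.pi, f x = ∫ x in (0 : ℝ)..(Real.pi / 2), f x := by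
    have := intervalIntegral.integral_comp_sub_left (a := 0) (b := Real.pi / 2) f Real.pi
    simp only [h2, sub_zero] at this
    rw [this]
    congr 1
    ring
  rw [← intervalIntegral.integral_add_adjacent_intervals (hi (-Real.pi) 0) (hi 0 Real.pi), e1,
    ← intervalIntegral.integral_add_adjacent_intervals (hi 0 (Real.pi / 2))
      (hi (Real.pi / 2) Real.pi), e2]
  ring

lemma abs_combination_le_iff (a b x y K : ℝ) :
    (|a * x + b * y| ≤ K ∧ |a * x - b * y| ≤ K) ↔ |a| * |x| + |b| * |y| ≤ K := by
  rw [← abs_mul, ← abs_mul]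
  generalize a * x = s
  generalize b * y = t
  constructor
  · rintro ⟨h1, h2⟩
    rw [abs_le] at h1 h2
    rcases abs_cases s with ⟨h, _⟩ | ⟨h, _⟩ <;> rcases abs_cases t with ⟨h', _⟩ | ⟨h', _⟩ <;>
      rw [h, h'] <;> linarith
  · intro h
    have := abs_add_le s t
    have := abs_sub s t
    constructor <;> linarith

/-- Writing `β = cos² θ`, the event `√β |Z| + √(1 - β) |Z'| ≤ K` is a rhombus whose sides are at
distance `K` from the origin, and `θ` only enters through the angular range of a side. -/
lemma qRect_eq_integral {K β : ℝ} (hK : 0 < K) (h0 : 0 ≤ β) (h1 : β ≤ 1) :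
    qRect K β = 1 - 2 / Real.pi * ∫ u in (-Real.arccos √β)..(Real.pi / 2 - Real.arccos √β),
      expNegInvGlue (2 * Real.cos u ^ 2 / K ^ 2) := by
  have hpi := Real.pi_pos
  set θ := Real.arccos √β with hθ
  have hs1 : √β ≤ 1 := Real.sqrt_le_one.2 h1
  have hcos : Real.cos θ = √β :=
    Real.cos_arccos (by linarith [Real.sqrt_nonneg β]) hs1
  have hsin : Real.sin θ = √(1 - β) := by rw [hθ, Real.sin_arccos, Real.sq_sqrt h0]
  set h : ℝ → ℝ := fun ω => √β * |Real.cos ω| + √(1 - β) * |Real.sin ω| with hh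
  have hc : Continuous h := by fun_prop
  have hn : ∀ ω, 0 ≤ h ω := fun ω => by positivity
  set A : Set (ℝ × ℝ) := {z | |couplePlus β z| ≤ K ∧ |coupleMinus β z| ≤ K} with hA
  have hAm : MeasurableSet A :=
    (measurableSet_le (measurable_couplePlus β).abs measurable_const).inter
      (measurableSet_le (measurable_coupleMinus β).abs measurable_const)
  have hAh : ∀ r ω : ℝ, 0 < r → ((r * Real.cos ω, r * Real.sin ω) ∈ Aᶜ ↔ K < r * h ω) := by
    intro r ω hr
    have e : (r * Real.cos ω, r * Real.sin ω) ∈ A ↔ r * h ω ≤ K := by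
      change (|√β * (r * Real.cos ω) + √(1 - β) * (r * Real.sin ω)| ≤ K ∧
        |√β * (r * Real.cos ω) - √(1 - β) * (r * Real.sin ω)| ≤ K) ↔ _
      rw [abs_combination_le_iff, abs_of_nonneg (Real.sqrt_nonneg _),
        abs_of_nonneg (Real.sqrt_nonneg _), abs_mul, abs_mul, abs_of_pos hr]
      have : √β * (r * |Real.cos ω|) + √(1 - β) * (r * |Real.sin ω|) = r * h ω := by
        rw [hh]; ring
      rw [this]
    rw [Set.mem_compl_iff, e, not_le]
  have key := measure_compl_star_eq_lintegral K hK h hn hAm.compl hAh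
  set f : ℝ → ℝ := fun ω => expNegInvGlue (2 * h ω ^ 2 / K ^ 2) with hf
  have hfc : Continuous f := continuous_expNegInvGlue.comp (by fun_prop)
  have hreal : ((gaussianReal 0 1).prod (gaussianReal 0 1)).real Aᶜ =
      (2 * Real.pi)⁻¹ * ∫ ω in (-Real.pi)..Real.pi, f ω := by
    rw [measureReal_def, key, ← intervalIntegral.integral_const_mul,
      intervalIntegral.integral_of_le (by linarith), ← integral_Ioc_eq_integral_Ioo.symm,
      ← ofReal_integral_eq_lintegral_ofReal, ENNReal.toReal_ofReal]
    · exact integral_nonneg fun ω => mul_nonneg (by positivity) (expNegInvGlue.nonneg _)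
    · exact ((hfc.const_mul _).integrableOn_Icc (a := -Real.pi) (b := Real.pi)).mono_set
        Set.Ioo_subset_Icc_self
    · exact ae_of_all _ fun ω => mul_nonneg (by positivity) (expNegInvGlue.nonneg _)
  rw [integral_fold f hfc (by intro x; simp [hf, hh]) (by intro x; simp [hf, hh])] at hreal
  have hq : qRect K β = 1 - ((gaussianReal 0 1).prod (gaussianReal 0 1)).real Aᶜ := by
    rw [probReal_compl_eq_one_sub hAm]
    simp [qRect, hA]
  have hshift : ∫ ω in (0 : ℝ)..(Real.pi / 2), f ω =
      ∫ u in (-θ)..(Real.pi / 2 - θ), expNegInvGlue (2 * Real.cos u ^ 2 / K ^ 2) := by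
    rw [← zero_sub θ, ← intervalIntegral.integral_comp_sub_right
      (fun u => expNegInvGlue (2 * Real.cos u ^ 2 / K ^ 2)) θ]
    refine intervalIntegral.integral_congr fun ω hω => ?_
    rw [Set.uIcc_of_le (by linarith)] at hω
    have c0 : 0 ≤ Real.cos ω := Real.cos_nonneg_of_mem_Icc ⟨by linarith [hω.1], hω.2⟩
    have s0 : 0 ≤ Real.sin ω := Real.sin_nonneg_of_nonneg_of_le_pi hω.1 (by linarith [hω.2])
    simp only [hf, hh]
    rw [abs_of_nonneg c0, abs_of_nonneg s0, Real.cos_sub, hcos, hsin, mul_comm √β,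
      mul_comm √(1 - β)]
  rw [hq, hreal, hshift]
  field_simp
  ring

lemma continuousOn_qRect {K : ℝ} (hK : 0 < K) : ContinuousOn (qRect K) (Set.Icc 0 1) := by
  have hg : Continuous fun u => expNegInvGlue (2 * Real.cos u ^ 2 / K ^ 2) :=
    continuous_expNegInvGlue.comp (by fun_prop)
  have hΦ : Continuous fun x => ∫ u in (0 : ℝ)..x, expNegInvGlue (2 * Real.cos u ^ 2 / K ^ 2) :=
    intervalIntegral.continuous_primitive (fun a b => hg.intervalIntegrable a b) 0
  have hc : Continuous fun β : ℝ => 1 - 2 / Real.pi *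
      ((∫ u in (0 : ℝ)..(Real.pi / 2 - Real.arccos √β),
        expNegInvGlue (2 * Real.cos u ^ 2 / K ^ 2)) -
      ∫ u in (0 : ℝ)..(-Real.arccos √β), expNegInvGlue (2 * Real.cos u ^ 2 / K ^ 2)) := by
    have ha : Continuous fun β : ℝ => Real.arccos √β :=
      Real.continuous_arccos.comp Real.continuous_sqrt
    exact continuous_const.sub (continuous_const.mul
      ((hΦ.comp (continuous_const.sub ha)).sub (hΦ.comp ha.neg)))
  refine hc.continuousOn.congr fun β hβ => ?_
  beta_reduce
  rw [qRect_eq_integral hK hβ.1 hβ.2, intervalIntegral.integral_interval_sub_left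
    (hg.intervalIntegrable _ _) (hg.intervalIntegrable _ _)]

/-- The derivative at `β` of both `qRect K` and `qU K`, for `β ∈ (0, 1)`. -/
noncomputable def qDeriv (K β : ℝ) : ℝ :=
  (Real.exp (-(K ^ 2 / (2 * β))) - Real.exp (-(K ^ 2 / (2 * (1 - β))))) /
    (Real.pi * (√β * √(1 - β)))

lemma hasDerivAt_qRect {K β : ℝ} (hK : 0 < K) (h0 : 0 < β) (h1 : β < 1) :
    HasDerivAt (qRect K) (qDeriv K β) β := by
  have hpi := Real.pi_pos
  set g : ℝ → ℝ := fun u => expNegInvGlue (2 * Real.cos u ^ 2 / K ^ 2) with hgdef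
  have hg : Continuous g := continuous_expNegInvGlue.comp (by fun_prop)
  have hs0 : 0 < √β := Real.sqrt_pos.2 h0
  have hs1 : √β < 1 := by rw [Real.sqrt_lt' one_pos]; simpa using h1
  have hs2 : 0 < √(1 - β) := Real.sqrt_pos.2 (by linarith)
  have hcos : Real.cos (Real.arccos √β) = √β := Real.cos_arccos (by linarith) hs1.le
  have hsin : Real.sin (Real.arccos √β) = √(1 - β) := by
    rw [Real.sin_arccos, Real.sq_sqrt h0.le]
  have hθ : HasDerivAt (fun β => Real.arccos √β) (-(1 / √(1 - β)) * (1 / (2 * √β))) β := by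
    have := (Real.hasDerivAt_arccos (x := √β) (by linarith) hs1.ne).comp β
      (Real.hasDerivAt_sqrt h0.ne')
    rwa [Real.sq_sqrt h0.le] at this
  have hΦ : ∀ x, HasDerivAt (fun x => ∫ u in (0 : ℝ)..x, g u) (g x) x := fun x =>
    intervalIntegral.integral_hasDerivAt_right (hg.intervalIntegrable _ _)
      (hg.stronglyMeasurableAtFilter _ _) hg.continuousAt
  have hd := (((((hΦ (Real.pi / 2 - Real.arccos √β)).comp β (hθ.const_sub (Real.pi / 2))).sub
    ((hΦ (-Real.arccos √β)).comp β hθ.fun_neg)).const_mul (2 / Real.pi)).const_sub 1)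
  have heq : qRect K =ᶠ[nhds β] fun β => 1 - 2 / Real.pi *
      ((∫ u in (0 : ℝ)..(Real.pi / 2 - Real.arccos √β), g u) -
        ∫ u in (0 : ℝ)..(-Real.arccos √β), g u) := by
    filter_upwards [Ioo_mem_nhds h0 h1] with b hb
    rw [qRect_eq_integral hK hb.1.le hb.2.le, intervalIntegral.integral_interval_sub_left
      (hg.intervalIntegrable _ _) (hg.intervalIntegrable _ _)]
  refine (hd.congr_of_eventuallyEq heq).congr_deriv ?_
  have e1 : g (Real.pi / 2 - Real.arccos √β) = Real.exp (-(K ^ 2 / (2 * (1 - β)))) := by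
    simp only [hgdef]
    rw [Real.cos_pi_div_two_sub, hsin, Real.sq_sqrt (by linarith), expNegInvGlue,
      if_neg (not_le.2 (div_pos (by linarith) (by positivity))), inv_div]
  have e2 : g (-Real.arccos √β) = Real.exp (-(K ^ 2 / (2 * β))) := by
    simp only [hgdef]
    rw [Real.cos_neg, hcos, Real.sq_sqrt h0.le, expNegInvGlue,
      if_neg (not_le.2 (div_pos (by linarith) (by positivity))), inv_div]
  rw [e1, e2, qDeriv]
  field_simp
  ring

/-! ### Laplace's method for binomial sums -/

lemma integrable_exp_sq_gaussian {b : ℝ} (hb : b < 1 / 2) :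
    Integrable (fun t => Real.exp (b * t ^ 2)) (gaussianReal 0 1) := by
  rw [gaussianReal_of_var_ne_zero 0 one_ne_zero,
    integrable_withDensity_iff_integrable_smul' (measurable_gaussianPDF 0 1)
      (ae_of_all _ fun x => gaussianPDF_lt_top)]
  have h := (integrable_exp_neg_mul_sq (b := 1 / 2 - b) (by linarith)).const_mul
    (√(2 * Real.pi))⁻¹
  refine h.congr (ae_of_all _ fun t => ?_)
  simp only [toReal_gaussianPDF, gaussianPDFReal, smul_eq_mul]
  rw [mul_assoc, ← Real.exp_add]
  simp only [NNReal.coe_one, mul_one, sub_zero]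
  congr 2
  ring

/-- The square in the exponent is linearised by a Gaussian integral,
`exp (y² / 2) = ∫ exp (y t) dγ(t)`. The binomial sum then becomes a power of `cosh`, and
`cosh s ≤ exp (s² / 2)` gives a bound without the loss of a power of `N`. -/
lemma sum_choose_exp_sq_le {c : ℝ} (hc0 : 0 ≤ c) (hc : c < 2) {N : ℕ} (hN : N ≠ 0) :
    ∑ l ∈ Finset.range (N + 1), N.choose l * Real.exp (c * N * ((l : ℝ) / N - 1 / 2) ^ 2) ≤
      (∫ t, Real.exp (c / 4 * t ^ 2) ∂(gaussianReal 0 1)) * 2 ^ N := by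
  have hN0 : (0 : ℝ) < N := by exact_mod_cast Nat.pos_of_ne_zero hN
  set s : ℝ := √(2 * c / N) with hs
  have hs2 : s ^ 2 = 2 * c / N := Real.sq_sqrt (by positivity)
  have hlin : ∀ l : ℕ, Real.exp (c * N * ((l : ℝ) / N - 1 / 2) ^ 2) =
      ∫ t, Real.exp (s * (l - N / 2) * t) ∂(gaussianReal 0 1) := by
    intro l
    have := congrFun (mgf_id_gaussianReal (μ := 0) (v := 1)) (s * (l - N / 2))
    rw [mgf] at this
    simp only [id] at this
    rw [this]
    congr 1
    have e : ((l : ℝ) / N - 1 / 2) = (l - N / 2) / N := by field_simp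
    rw [e, NNReal.coe_one, mul_pow, hs2]
    field_simp
    ring
  have hint : ∀ l : ℕ, Integrable (fun t => Real.exp (s * (l - N / 2) * t)) (gaussianReal 0 1) :=
    fun l => integrable_exp_mul_gaussianReal _
  simp_rw [hlin, ← integral_const_mul]
  rw [← integral_finsetSum _ fun l _ => (hint l).const_mul _, ← integral_mul_const]
  refine integral_mono (integrable_finsetSum _ fun l _ => (hint l).const_mul _)
    ((integrable_exp_sq_gaussian (by linarith)).mul_const _) fun t => ?_
  have hbin : ∑ l ∈ Finset.range (N + 1), (N.choose l : ℝ) * Real.exp (s * (l - N / 2) * t) =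
      (2 * Real.cosh (s * t / 2)) ^ N := by
    rw [Real.cosh_eq, mul_div_cancel₀ _ two_ne_zero, add_pow]
    refine Finset.sum_congr rfl fun l hl => ?_
    have hl' : l ≤ N := Nat.lt_succ_iff.1 (Finset.mem_range.1 hl)
    rw [← Real.exp_nat_mul, ← Real.exp_nat_mul, ← Real.exp_add, mul_comm, Nat.cast_sub hl']
    congr 2
    ring
  change ∑ l ∈ Finset.range (N + 1), (N.choose l : ℝ) * Real.exp (s * (l - N / 2) * t) ≤ _
  rw [hbin, mul_pow, mul_comm]
  refine mul_le_mul_of_nonneg_right ?_ (by positivity)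
  calc Real.cosh (s * t / 2) ^ N ≤ Real.exp ((s * t / 2) ^ 2 / 2) ^ N :=
        pow_le_pow_left₀ (Real.cosh_pos _).le (Real.cosh_le_exp_half_sq _) N
    _ = Real.exp (c / 4 * t ^ 2) := by
        rw [← Real.exp_nat_mul, div_pow, mul_pow, hs2]
        congr 1
        field_simp
        ring

/-- One term of the binomial expansion of `(β + (1 - β)) ^ N` at `β = l / N` is at most `1`. -/
lemma choose_le_exp_binEntropy {N l : ℕ} (hN : N ≠ 0) (hl : l ≤ N) :
    (N.choose l : ℝ) ≤ Real.exp (N * Real.binEntropy ((l : ℝ) / N)) := by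
  have hN0 : (0 : ℝ) < N := by exact_mod_cast Nat.pos_of_ne_zero hN
  set β : ℝ := (l : ℝ) / N with hβ
  have hlβ : (l : ℝ) = N * β := by rw [hβ]; field_simp
  have hβ0 : 0 ≤ β := by positivity
  have hβ1 : β ≤ 1 := by rw [hβ, div_le_one hN0]; exact_mod_cast hl
  have hpow : ∀ (x : ℝ) (k : ℕ), 0 ≤ x → (x = 0 → k = 0) → x ^ k = Real.exp (k * Real.log x) := by
    intro x k hx hk
    rcases hx.eq_or_lt with h | h
    · rw [hk h.symm]; simp
    · rw [Real.exp_nat_mul, Real.exp_log h]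
  have hsum : (β + (1 - β)) ^ N = 1 := by simp
  rw [add_pow] at hsum
  have hterm : β ^ l * (1 - β) ^ (N - l) * (N.choose l : ℝ) ≤ 1 := by
    refine le_trans ?_ hsum.le
    refine Finset.single_le_sum (f := fun m => β ^ m * (1 - β) ^ (N - m) * (N.choose m : ℝ))
      (fun m _ => ?_) (Finset.mem_range.2 (Nat.lt_succ_iff.2 hl))
    have : 0 ≤ 1 - β := sub_nonneg.2 hβ1
    positivity
  have h1 : β ^ l = Real.exp (l * Real.log β) := by
    refine hpow _ _ hβ0 fun h => ?_
    rw [h, mul_zero] at hlβ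
    exact_mod_cast hlβ
  have h2 : (1 - β) ^ (N - l) = Real.exp ((N - l : ℕ) * Real.log (1 - β)) := by
    refine hpow _ _ (sub_nonneg.2 hβ1) fun h => ?_
    have : β = 1 := by linarith
    rw [this, mul_one] at hlβ
    have : l = N := by exact_mod_cast hlβ
    omega
  rw [h1, h2, ← Real.exp_add, Nat.cast_sub hl, hlβ] at hterm
  have e : N * β * Real.log β + (N - N * β) * Real.log (1 - β) = -(N * Real.binEntropy β) := by
    rw [Real.binEntropy_eq_negMulLog_add_negMulLog_one_sub, Real.negMulLog, Real.negMulLog]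
    ring
  rw [e, Real.exp_neg, inv_mul_le_iff₀ (Real.exp_pos _), mul_one] at hterm
  exact hterm

/-- Laplace's method: if the exponent `binEntropy β + α log (q β / P)` is at most
`log 2 - (2 - c) (β - 1/2)²` to second order near `1 / 2`, and below `log 2` by a fixed amount
elsewhere, then the binomial sum is of order `2 ^ N`. -/
lemma exists_sum_choose_mul_pow_le {q : ℝ → ℝ} {P α ε c η : ℝ} (hα : 0 < α) (hP : 0 < P)
    (hc0 : 0 ≤ c) (hc : c < 2) (hη : 0 < η) (hq : ∀ β ∈ Set.Icc (0 : ℝ) 1, P ≤ q β)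
    (hnear : ∀ β ∈ Set.Icc (0 : ℝ) 1, |β - 1 / 2| ≤ ε →
      α * Real.log (q β / P) ≤ c * (β - 1 / 2) ^ 2)
    (hfar : ∀ β ∈ Set.Icc (0 : ℝ) 1, ε < |β - 1 / 2| →
      Real.binEntropy β + α * Real.log (q β / P) ≤ Real.log 2 - η) :
    ∃ C : ℝ, 0 < C ∧ ∀ N : ℕ, N ≠ 0 →
      ∑ l ∈ Finset.range (N + 1), N.choose l * q ((l : ℝ) / N) ^ ⌊α * N⌋₊ ≤
        C * 2 ^ N * P ^ ⌊α * N⌋₊ := by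
  set I := ∫ t, Real.exp (c / 4 * t ^ 2) ∂(gaussianReal 0 1) with hI
  have hI0 : 0 ≤ I := integral_nonneg fun t => (Real.exp_pos _).le
  refine ⟨I + (1 + 1 / η), by positivity, fun N hN => ?_⟩
  have hN0 : (0 : ℝ) < N := by exact_mod_cast Nat.pos_of_ne_zero hN
  set M := ⌊α * N⌋₊ with hM
  have hMle : (M : ℝ) ≤ α * N := Nat.floor_le (by positivity)
  have hterm : ∀ l ∈ Finset.range (N + 1), (N.choose l : ℝ) * q ((l : ℝ) / N) ^ M ≤
      (N.choose l * Real.exp (c * N * ((l : ℝ) / N - 1 / 2) ^ 2) +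
        2 ^ N * Real.exp (-(N * η))) * P ^ M := by
    intro l hl
    have hl' : l ≤ N := Nat.lt_succ_iff.1 (Finset.mem_range.1 hl)
    set β : ℝ := (l : ℝ) / N with hβ
    have hβm : β ∈ Set.Icc (0 : ℝ) 1 :=
      ⟨by positivity, by rw [hβ, div_le_one hN0]; exact_mod_cast hl'⟩
    -- As `1 ≤ q β / P`, the exponent `⌊α N⌋` may be replaced by the larger `α N`.
    have hr1 : 1 ≤ q β / P := (one_le_div hP).2 (hq β hβm)
    have hpow : q β ^ M ≤ Real.exp (N * (α * Real.log (q β / P))) * P ^ M := by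
      have e1 : q β ^ M = (q β / P) ^ M * P ^ M := by rw [div_pow, div_mul_cancel₀ _ (by positivity)]
      have e2 : (q β / P) ^ M = Real.exp (M * Real.log (q β / P)) := by
        rw [Real.exp_nat_mul, Real.exp_log (by linarith)]
      rw [e1, e2]
      refine mul_le_mul_of_nonneg_right (Real.exp_le_exp.2 ?_) (by positivity)
      calc M * Real.log (q β / P) ≤ α * N * Real.log (q β / P) :=
            mul_le_mul_of_nonneg_right hMle (Real.log_nonneg hr1)
        _ = _ := by ring
    refine (mul_le_mul_of_nonneg_left hpow (Nat.cast_nonneg _)).trans ?_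
    rw [← mul_assoc]
    refine mul_le_mul_of_nonneg_right ?_ (by positivity)
    rcases le_or_gt |β - 1 / 2| ε with h | h
    · refine le_add_of_le_of_nonneg (mul_le_mul_of_nonneg_left (Real.exp_le_exp.2 ?_)
        (Nat.cast_nonneg _)) (by positivity)
      have := mul_le_mul_of_nonneg_left (hnear β hβm h) hN0.le
      linarith
    · refine le_add_of_nonneg_of_le (by positivity) ?_
      refine (mul_le_mul_of_nonneg_right (choose_le_exp_binEntropy hN hl')
        (Real.exp_pos _).le).trans ?_
      rw [← Real.exp_add]
      have e : (2 : ℝ) ^ N = Real.exp (N * Real.log 2) := by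
        rw [Real.exp_nat_mul, Real.exp_log two_pos]
      rw [e, ← Real.exp_add]
      refine Real.exp_le_exp.2 ?_
      have := mul_le_mul_of_nonneg_left (hfar β hβm h) hN0.le
      linarith
  refine (Finset.sum_le_sum hterm).trans ?_
  rw [← Finset.sum_mul, Finset.sum_add_distrib]
  refine mul_le_mul_of_nonneg_right ?_ (by positivity)
  rw [add_mul]
  refine add_le_add (sum_choose_exp_sq_le hc0 hc hN) ?_
  rw [Finset.sum_const, Finset.card_range, nsmul_eq_mul, mul_left_comm,
    mul_comm (1 + 1 / η)]
  refine mul_le_mul_of_nonneg_left ?_ (by positivity)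
  rw [Real.exp_neg, ← div_eq_mul_inv, div_le_iff₀ (Real.exp_pos _)]
  have h1 : 1 + N * η ≤ Real.exp (N * η) := by linarith [Real.add_one_le_exp (N * η)]
  calc ((N + 1 : ℕ) : ℝ) ≤ (1 + 1 / η) * (1 + N * η) := by
        push_cast
        have : (1 + 1 / η) * (1 + N * η) = 1 + N + N * η + 1 / η := by field_simp; ring
        rw [this]
        have : 0 < 1 / η := by positivity
        have : 0 < N * η := by positivity
        linarith
    _ ≤ _ := mul_le_mul_of_nonneg_left h1 (by positivity)

/-! ### The Gaussian mass of an interval and the Mills ratio -/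

/-- The standard Gaussian density. -/
noncomputable def gaussDensity (x : ℝ) : ℝ := (√(2 * Real.pi))⁻¹ * Real.exp (-x ^ 2 / 2)

/-- The mass `2 ∫₀ᴷ φ` of `[-K, K]` under the standard Gaussian, as a function that is smooth on the
whole line (it is odd, whereas `pRect K` vanishes for `K < 0`). -/
noncomputable def gaussMass (K : ℝ) : ℝ := 2 * ∫ t in (0 : ℝ)..K, gaussDensity t

lemma gaussDensity_pos (x : ℝ) : 0 < gaussDensity x := by
  have := Real.pi_pos
  unfold gaussDensity; positivity

lemma continuous_gaussDensity : Continuous gaussDensity := by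
  unfold gaussDensity; fun_prop

lemma gaussDensity_sq (x : ℝ) : gaussDensity x ^ 2 = Real.exp (-x ^ 2) / (2 * Real.pi) := by
  have := Real.pi_pos
  rw [gaussDensity, mul_pow, inv_pow, Real.sq_sqrt (by positivity), ← Real.exp_nat_mul,
    div_eq_inv_mul (Real.exp (-x ^ 2))]
  congr 2
  push_cast
  ring

lemma hasDerivAt_gaussDensity (x : ℝ) : HasDerivAt gaussDensity (-x * gaussDensity x) x := by
  have h := ((((hasDerivAt_id x).pow 2).neg.div_const 2).exp).const_mul (√(2 * Real.pi))⁻¹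
  refine h.congr_deriv ?_
  simp [gaussDensity]; ring

lemma hasDerivAt_gaussMass (K : ℝ) : HasDerivAt gaussMass (2 * gaussDensity K) K :=
  (intervalIntegral.integral_hasDerivAt_right (continuous_gaussDensity.intervalIntegrable _ _)
    (continuous_gaussDensity.stronglyMeasurableAtFilter _ _)
    continuous_gaussDensity.continuousAt).const_mul 2

lemma gaussMass_zero : gaussMass 0 = 0 := by simp [gaussMass]

lemma pRect_eq_gaussMass {K : ℝ} (hK : 0 ≤ K) : pRect K = gaussMass K := by
  have hset : {z : ℝ | |z| ≤ K} = Set.Icc (-K) K := by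
    ext z; simp [abs_le]
  have hpdf : ∀ x, gaussianPDFReal 0 1 x = gaussDensity x := by
    intro x; simp [gaussianPDFReal, gaussDensity]
  rw [pRect, hset, measureReal_def, gaussianReal_apply_eq_integral 0 one_ne_zero,
    ENNReal.toReal_ofReal (integral_nonneg fun x => gaussianPDFReal_nonneg _ _ _)]
  simp_rw [hpdf]
  have hi : ∀ a b, IntervalIntegrable gaussDensity volume a b := fun a b =>
    continuous_gaussDensity.intervalIntegrable a b
  rw [integral_Icc_eq_integral_Ioc, ← intervalIntegral.integral_of_le (by linarith),
    ← intervalIntegral.integral_add_adjacent_intervals (hi (-K) 0) (hi 0 K)]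
  have h := intervalIntegral.integral_comp_neg (a := 0) (b := K) gaussDensity
  have he : ∀ x, gaussDensity (-x) = gaussDensity x := by intro x; simp [gaussDensity]
  simp only [he, neg_zero] at h
  rw [← h, gaussMass]
  ring

lemma tendsto_gaussMass : Tendsto gaussMass atTop (nhds 1) := by
  have hint : IntegrableOn gaussDensity (Set.Ioi 0) := by
    refine Integrable.integrableOn ?_
    have := (integrable_exp_neg_mul_sq (b := 1 / 2) (by norm_num)).const_mul (√(2 * Real.pi))⁻¹
    refine this.congr (ae_of_all _ fun x => ?_)
    simp only [gaussDensity]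
    congr 2
    ring
  have h := (intervalIntegral_tendsto_integral_Ioi 0 hint tendsto_id).const_mul 2
  have hv : ∫ x in Set.Ioi 0, gaussDensity x = 1 / 2 := by
    have e : gaussDensity = fun x => (√(2 * Real.pi))⁻¹ * Real.exp (-(1 / 2) * x ^ 2) := by
      funext x
      simp only [gaussDensity]
      congr 2
      ring
    have hp : √(2 * Real.pi) ≠ 0 := by have := Real.pi_pos; positivity
    rw [e, integral_const_mul, integral_gaussian_Ioi,
      show Real.pi / (1 / 2) = 2 * Real.pi by ring]
    field_simp
  rw [hv, mul_one_div_cancel two_ne_zero] at h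
  exact h

lemma strictMono_gaussMass : StrictMono gaussMass :=
  strictMono_of_deriv_pos fun x => by
    rw [(hasDerivAt_gaussMass x).deriv]
    exact mul_pos two_pos (gaussDensity_pos x)

lemma gaussMass_pos {K : ℝ} (hK : 0 < K) : 0 < gaussMass K := by
  rw [← gaussMass_zero]; exact strictMono_gaussMass hK

lemma gaussMass_lt_one (K : ℝ) : gaussMass K < 1 :=
  (strictMono_gaussMass (lt_add_one K)).trans_le
    (strictMono_gaussMass.monotone.ge_of_tendsto tendsto_gaussMass (K + 1))

lemma le_of_hasDerivAt_nonneg {f f' : ℝ → ℝ} {a b : ℝ} (hab : a ≤ b)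
    (hc : ContinuousOn f (Set.Icc a b)) (hd : ∀ x ∈ Set.Ioo a b, HasDerivAt f (f' x) x)
    (hf : ∀ x ∈ Set.Ioo a b, 0 ≤ f' x) : f a ≤ f b := by
  refine monotoneOn_of_deriv_nonneg (convex_Icc a b) hc ?_ ?_ (Set.left_mem_Icc.2 hab)
    (Set.right_mem_Icc.2 hab) hab
  · rw [interior_Icc]
    exact fun x hx => (hd x hx).differentiableAt.differentiableWithinAt
  · rw [interior_Icc]
    intro x hx
    rw [(hd x hx).deriv]
    exact hf x hx

/-- Both sides vanish at `0`, and the hypothesis compares their derivatives. In the application `T`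
is a partial sum of `∑ xⁿ / (2 n + 1)‼` at `x = K²`, for which the left side of `h` telescopes. -/
lemma mul_le_gaussMass {T T' : ℝ → ℝ} (hT : ∀ x, HasDerivAt T (T' x) x)
    (h : ∀ x, 0 < x → T x * (1 - x ^ 2) + x * T' x ≤ 1) {K : ℝ} (hK : 0 ≤ K) :
    2 * K * gaussDensity K * T K ≤ gaussMass K := by
  have hd : ∀ x, HasDerivAt (fun x => gaussMass x - 2 * x * gaussDensity x * T x)
      (2 * gaussDensity x * (1 - (T x * (1 - x ^ 2) + x * T' x))) x := by
    intro x
    have := (hasDerivAt_gaussMass x).sub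
      ((((hasDerivAt_id x).const_mul 2).mul (hasDerivAt_gaussDensity x)).mul (hT x))
    refine this.congr_deriv ?_
    simp; ring
  have := le_of_hasDerivAt_nonneg hK
    (fun x _ => (hd x).continuousAt.continuousWithinAt) (fun x _ => hd x)
    (fun x hx => mul_nonneg (mul_nonneg two_pos.le (gaussDensity_pos x).le)
      (sub_nonneg.2 (h x hx.1)))
  simp only [gaussMass_zero] at this
  linarith

lemma gaussMass_le_mul {T T' : ℝ → ℝ} (hT : ∀ x, HasDerivAt T (T' x) x) {K : ℝ} (hK : 0 ≤ K)
    (h : ∀ x ∈ Set.Ioo 0 K, 1 ≤ T x * (1 - x ^ 2) + x * T' x) :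
    gaussMass K ≤ 2 * K * gaussDensity K * T K := by
  have hd : ∀ x, HasDerivAt (fun x => 2 * x * gaussDensity x * T x - gaussMass x)
      (2 * gaussDensity x * (T x * (1 - x ^ 2) + x * T' x - 1)) x := by
    intro x
    have := ((((hasDerivAt_id x).const_mul 2).mul (hasDerivAt_gaussDensity x)).mul (hT x)).sub
      (hasDerivAt_gaussMass x)
    refine this.congr_deriv ?_
    simp; ring
  have := le_of_hasDerivAt_nonneg hK
    (fun x _ => (hd x).continuousAt.continuousWithinAt) (fun x _ => hd x)
    (fun x hx => mul_nonneg (mul_nonneg two_pos.le (gaussDensity_pos x).le)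
      (sub_nonneg.2 (h x hx)))
  simp only [gaussMass_zero] at this
  linarith

lemma tendsto_gaussDensity : Tendsto gaussDensity atTop (nhds 0) := by
  unfold gaussDensity
  rw [← mul_zero (√(2 * Real.pi))⁻¹]
  refine (Real.tendsto_exp_atBot.comp ?_).const_mul _
  have : Tendsto (fun r : ℝ => r ^ 2 / 2) atTop atTop :=
    (tendsto_pow_atTop two_ne_zero).atTop_div_const two_pos
  refine (tendsto_neg_atTop_atBot.comp this).congr fun r => ?_
  simp [neg_div]

/-- A convergent of the continued fraction of the Mills ratio: the difference of the two sides is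
antitone and tends to `0` at infinity. -/
lemma mills_lower (K : ℝ) :
    2 * gaussDensity K * (K * (K ^ 2 + 5) / (K ^ 4 + 6 * K ^ 2 + 3)) ≤ 1 - gaussMass K := by
  set r : ℝ → ℝ := fun x => x * (x ^ 2 + 5) / (x ^ 4 + 6 * x ^ 2 + 3) with hr
  have hden : ∀ x : ℝ, 0 < x ^ 4 + 6 * x ^ 2 + 3 := fun x => by positivity
  have hrd : ∀ x, HasDerivAt r (((3 * x ^ 2 + 5) * (x ^ 4 + 6 * x ^ 2 + 3) -
      x * (x ^ 2 + 5) * (4 * x ^ 3 + 12 * x)) / (x ^ 4 + 6 * x ^ 2 + 3) ^ 2) x := by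
    intro x
    have h1 : HasDerivAt (fun x : ℝ => x * (x ^ 2 + 5)) (3 * x ^ 2 + 5) x := by
      refine ((hasDerivAt_id x).mul (((hasDerivAt_id x).pow 2).add_const 5)).congr_deriv ?_
      simp; ring
    have h2 : HasDerivAt (fun x : ℝ => x ^ 4 + 6 * x ^ 2 + 3) (4 * x ^ 3 + 12 * x) x := by
      refine (((hasDerivAt_pow 4 x).add ((hasDerivAt_pow 2 x).const_mul 6)).add_const 3).congr_deriv
        ?_
      simp; ring
    exact h1.div h2 (hden x).ne'
  have hd : ∀ x, HasDerivAt (fun x => 1 - gaussMass x - 2 * gaussDensity x * r x)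
      (-(2 * gaussDensity x * (24 / (x ^ 4 + 6 * x ^ 2 + 3) ^ 2))) x := by
    intro x
    refine (((hasDerivAt_gaussMass x).const_sub 1).sub
      (((hasDerivAt_gaussDensity x).const_mul 2).mul (hrd x))).congr_deriv ?_
    simp only [hr]
    have := (hden x).ne'
    field_simp
    ring
  have hanti : Antitone fun x => 1 - gaussMass x - 2 * gaussDensity x * r x := by
    refine antitone_of_deriv_nonpos (fun x => (hd x).differentiableAt) fun x => ?_
    rw [(hd x).deriv]
    have := gaussDensity_pos x
    have := hden x
    exact neg_nonpos.2 (by positivity)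
  have hrb : ∀ x, 0 ≤ x → 0 ≤ r x ∧ r x ≤ 2 := by
    intro x hx
    refine ⟨div_nonneg (by positivity) (hden x).le, ?_⟩
    rw [hr]
    simp only
    rw [div_le_iff₀ (hden x)]
    nlinarith [sq_nonneg (x ^ 2 - x), sq_nonneg (x - 1), sq_nonneg (x ^ 2)]
  have hlim : Tendsto (fun x => 1 - gaussMass x - 2 * gaussDensity x * r x) atTop (nhds 0) := by
    have h1 : Tendsto (fun x => 1 - gaussMass x) atTop (nhds 0) := by
      simpa using tendsto_gaussMass.const_sub 1
    have h2 : Tendsto (fun x => 2 * gaussDensity x * r x) atTop (nhds 0) := by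
      have h4 : Tendsto (fun x => 2 * gaussDensity x * 2) atTop (nhds 0) := by
        simpa using (tendsto_gaussDensity.const_mul 2).mul_const 2
      refine tendsto_of_tendsto_of_tendsto_of_le_of_le' tendsto_const_nhds h4 ?_ ?_
      · filter_upwards [eventually_ge_atTop 0] with x hx
        have := gaussDensity_pos x
        have := (hrb x hx).1
        positivity
      · filter_upwards [eventually_ge_atTop 0] with x hx
        exact mul_le_mul_of_nonneg_left (hrb x hx).2
          (mul_nonneg two_pos.le (gaussDensity_pos x).le)
    simpa using h1.sub h2
  have := hanti.le_of_tendsto hlim K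
  simp only [hr] at this
  linarith

lemma mills_upper {K : ℝ} (hK : 0 < K) : K * (1 - gaussMass K) < 2 * gaussDensity K := by
  have hd : ∀ x ∈ Set.Ici K, HasDerivAt (fun x => 2 * gaussDensity x / x - (1 - gaussMass x))
      (-(2 * gaussDensity x / x ^ 2)) x := by
    intro x hx
    have hx0 : x ≠ 0 := (hK.trans_le hx).ne'
    refine ((((hasDerivAt_gaussDensity x).const_mul 2).div (hasDerivAt_id x) hx0).sub
      ((hasDerivAt_gaussMass x).const_sub 1)).congr_deriv ?_
    simp
    field_simp
    ring
  have hanti : StrictAntiOn (fun x => 2 * gaussDensity x / x - (1 - gaussMass x)) (Set.Ici K) := by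
    refine strictAntiOn_of_deriv_neg (convex_Ici K)
      (fun x hx => (hd x hx).continuousAt.continuousWithinAt) fun x hx => ?_
    rw [interior_Ici] at hx
    rw [(hd x (Set.Ioi_subset_Ici_self hx)).deriv]
    have := gaussDensity_pos x
    have : 0 < x := hK.trans hx
    exact neg_neg_of_pos (by positivity)
  have hlim : Tendsto (fun x => 2 * gaussDensity x / x - (1 - gaussMass x)) atTop (nhds 0) := by
    have h1 : Tendsto (fun x => 1 - gaussMass x) atTop (nhds 0) := by
      simpa using tendsto_gaussMass.const_sub 1
    have h2 : Tendsto (fun x => 2 * gaussDensity x / x) atTop (nhds 0) :=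
      (by simpa using tendsto_gaussDensity.const_mul 2 :
        Tendsto (fun x => 2 * gaussDensity x) atTop (nhds 0)).div_atTop tendsto_id
    simpa using h2.sub h1
  have h1 : 0 ≤ 2 * gaussDensity (K + 1) / (K + 1) - (1 - gaussMass (K + 1)) := by
    refine le_of_tendsto hlim ?_
    filter_upwards [eventually_ge_atTop (K + 1)] with x hx
    have h0 : K ≤ K + 1 := by linarith
    exact hanti.antitoneOn h0 (h0.trans hx) hx
  have h2 := hanti (Set.self_mem_Ici) (show K ≤ K + 1 by linarith) (lt_add_one K)
  have h3 : 1 - gaussMass K < 2 * gaussDensity K / K := by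
    simp only at h2; linarith
  rw [lt_div_iff₀ hK] at h3
  linarith

/-! ### The threshold inequality for the u-function -/

/-- With `p = 1 - gaussMass`, `L = -log p` and `m = L'`, this is `K m / 2 ≤ L`. The derivative of
`L - K m / 2` has the sign of `1 - K (m - K)`, which is nonnegative as `m ≤ K + 1 / K`. -/
lemma mul_gaussDensity_le_neg_log {K : ℝ} (hK : 0 < K) :
    K * gaussDensity K / (1 - gaussMass K) ≤ -Real.log (1 - gaussMass K) := by
  have hp : ∀ x, 0 < 1 - gaussMass x := fun x => sub_pos.2 (gaussMass_lt_one x)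
  have hd : ∀ x, HasDerivAt (fun x => -Real.log (1 - gaussMass x) -
        x * gaussDensity x / (1 - gaussMass x))
      (gaussDensity x / (1 - gaussMass x) ^ 2 *
        ((1 + x ^ 2) * (1 - gaussMass x) - 2 * x * gaussDensity x)) x := by
    intro x
    have h1 := (hasDerivAt_gaussMass x).const_sub 1
    refine ((h1.log (hp x).ne').neg.sub
      (((hasDerivAt_id x).mul (hasDerivAt_gaussDensity x)).div h1 (hp x).ne')).congr_deriv ?_
    have := (hp x).ne'
    simp
    field_simp
    ring
  have := le_of_hasDerivAt_nonneg hK.le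
    (fun x _ => (hd x).continuousAt.continuousWithinAt) (fun x _ => hd x) (fun x hx => by
      have hx0 : 0 < x := hx.1
      have hg := gaussDensity_pos x
      refine mul_nonneg (div_nonneg hg.le (sq_nonneg _)) (sub_nonneg.2 ?_)
      have hm := mills_lower x
      have hr : x / (1 + x ^ 2) ≤ x * (x ^ 2 + 5) / (x ^ 4 + 6 * x ^ 2 + 3) := by
        rw [div_le_div_iff₀ (by positivity) (by positivity)]
        nlinarith [sq_nonneg x]
      have h3 : 2 * gaussDensity x * (x / (1 + x ^ 2)) ≤ 1 - gaussMass x :=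
        (mul_le_mul_of_nonneg_left hr (by positivity)).trans hm
      rw [← mul_div_assoc, div_le_iff₀ (by positivity)] at h3
      linarith)
  simp only [gaussMass_zero, sub_zero, Real.log_one, neg_zero, zero_mul, zero_div] at this
  linarith

/-- With `p`, `L`, `m` as in `mul_gaussDensity_le_neg_log`, the derivative is
`2 (K - m) + (m / L - 2 / K)`, where `K < m` by `mills_upper` and `m / L ≤ 2 / K`. -/
lemma strictAntiOn_uThreshold :
    StrictAntiOn (fun K => 2 * Real.log (1 - gaussMass K) + K ^ 2 +
      Real.log (-Real.log (1 - gaussMass K)) - 2 * Real.log K) (Set.Ioi 0) := by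
  have hp : ∀ x, 0 < 1 - gaussMass x := fun x => sub_pos.2 (gaussMass_lt_one x)
  have hL : ∀ x, 0 < x → 0 < -Real.log (1 - gaussMass x) := fun x hx =>
    neg_pos.2 (Real.log_neg (hp x) (by linarith [gaussMass_pos hx]))
  have hd : ∀ x, 0 < x → HasDerivAt (fun K => 2 * Real.log (1 - gaussMass K) + K ^ 2 +
      Real.log (-Real.log (1 - gaussMass K)) - 2 * Real.log K)
      (2 * (-(2 * gaussDensity x) / (1 - gaussMass x)) + 2 * x +
        (2 * gaussDensity x / (1 - gaussMass x)) / (-Real.log (1 - gaussMass x)) - 2 * (1 / x))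
      x := by
    intro x hx
    have h1 := ((hasDerivAt_gaussMass x).const_sub 1).log (hp x).ne'
    have h2 := (h1.neg).log (hL x hx).ne'
    refine ((((h1.const_mul 2).add (hasDerivAt_pow 2 x)).add h2).sub
      ((Real.hasDerivAt_log hx.ne').const_mul 2)).congr_deriv ?_
    have := (hp x).ne'
    simp
    ring
  refine strictAntiOn_of_deriv_neg (convex_Ioi 0)
    (fun x hx => (hd x hx).continuousAt.continuousWithinAt) fun x hx => ?_
  rw [interior_Ioi] at hx
  have hx0 : 0 < x := hx
  rw [(hd x hx).deriv]
  have h1 := mul_gaussDensity_le_neg_log hx0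
  have h2 := mills_upper hx0
  have e1 : (2 * gaussDensity x / (1 - gaussMass x)) / (-Real.log (1 - gaussMass x)) ≤
      2 * (1 / x) := by
    rw [div_le_iff₀ (hL x hx0)]
    calc 2 * gaussDensity x / (1 - gaussMass x) =
          2 * (1 / x) * (x * gaussDensity x / (1 - gaussMass x)) := by
          have := (hp x).ne'
          field_simp
      _ ≤ _ := mul_le_mul_of_nonneg_left h1 (by positivity)
  have e2 : x < 2 * gaussDensity x / (1 - gaussMass x) := by
    rwa [lt_div_iff₀ (hp x)]
  have e3 : -(2 * gaussDensity x) / (1 - gaussMass x) =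
      -(2 * gaussDensity x / (1 - gaussMass x)) := neg_div _ _
  rw [e3]
  linarith

/-- The logarithm of `p² exp (K²) (-log p) / K²` is strictly antitone in `K`, and the equation for
`Kstar` fixes its value there. -/
lemma uThreshold {K Kstar : ℝ} (hK : 0 < K) (hs : IsKStar Kstar) (hlt : K < Kstar) :
    2 * Real.log 2 * K ^ 2 ≤ Real.pi * pU K ^ 2 * Real.exp (K ^ 2) * (-Real.log (pU K)) := by
  obtain ⟨hs0, hs⟩ := hs
  have hpi := Real.pi_pos
  have hp : ∀ x, 0 < x → 0 < pU x ∧ 0 < -Real.log (pU x) ∧ pU x = 1 - gaussMass x := by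
    intro x hx
    have e : pU x = 1 - gaussMass x := by rw [pU_eq, pRect_eq_gaussMass hx.le]
    have h0 : 0 < 1 - gaussMass x := sub_pos.2 (gaussMass_lt_one x)
    exact ⟨e ▸ h0, neg_pos.2 (Real.log_neg (e ▸ h0) (by linarith [gaussMass_pos hx])), e⟩
  have hlog : ∀ x, 0 < x → Real.log (pU x ^ 2 * Real.exp (x ^ 2) * (-Real.log (pU x)) / x ^ 2) =
      2 * Real.log (1 - gaussMass x) + x ^ 2 + Real.log (-Real.log (1 - gaussMass x)) -
        2 * Real.log x := by
    intro x hx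
    obtain ⟨h1, h2, h3⟩ := hp x hx
    rw [Real.log_div (by positivity) (by positivity), Real.log_mul (by positivity) h2.ne',
      Real.log_mul (by positivity) (by positivity), Real.log_exp, Real.log_pow, Real.log_pow, h3]
    push_cast
    ring
  obtain ⟨h1, h2, h3⟩ := hp K hK
  obtain ⟨h1', h2', h3'⟩ := hp Kstar hs0
  have key := strictAntiOn_uThreshold (Set.mem_Ioi.2 hK) (Set.mem_Ioi.2 hs0) hlt
  simp only [← hlog K hK, ← hlog Kstar hs0] at key
  rw [Real.log_lt_log_iff (by positivity) (by positivity)] at key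
  have e : pU Kstar ^ 2 * Real.exp (Kstar ^ 2) * (-Real.log (pU Kstar)) / Kstar ^ 2 =
      2 * Real.log 2 / Real.pi := by
    rw [div_eq_div_iff (by positivity) (by positivity)]
    linarith
  rw [e, div_lt_div_iff₀ (by positivity) (by positivity)] at key
  linarith

/-! ### The threshold inequality for the rectangle function -/

lemma sum_pow_div_le_neg_log {y : ℝ} (h0 : 0 ≤ y) (h1 : y < 1) (n : ℕ) :
    ∑ k ∈ Finset.range n, y ^ (k + 1) / (k + 1) ≤ -Real.log (1 - y) :=
  sum_le_hasSum _ (fun k _ => by positivity)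
    (Real.hasSum_pow_div_log_of_abs_lt_one (by rwa [abs_of_nonneg h0]))

/-- The logarithmic derivative `K p' / p` of the mass `p` of `[-K, K]`, with respect to `log K`. -/
noncomputable def logSlope (K : ℝ) : ℝ := 2 * K * gaussDensity K / gaussMass K

lemma logSlope_pos {K : ℝ} (hK : 0 < K) : 0 < logSlope K := by
  have := gaussMass_pos hK
  have := gaussDensity_pos K
  unfold logSlope; positivity

lemma logSlope_le {T T' : ℝ → ℝ} (hT : ∀ x, HasDerivAt T (T' x) x)
    (h : ∀ x, 0 < x → T x * (1 - x ^ 2) + x * T' x ≤ 1) {K : ℝ} (hK : 0 < K) (hTK : 0 < T K) :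
    logSlope K ≤ 1 / T K := by
  rw [logSlope, div_le_div_iff₀ (gaussMass_pos hK) hTK, one_mul]
  exact mul_le_gaussMass hT h hK.le

lemma le_logSlope {T T' : ℝ → ℝ} (hT : ∀ x, HasDerivAt T (T' x) x) {K : ℝ} (hK : 0 < K)
    (h : ∀ x ∈ Set.Ioo 0 K, 1 ≤ T x * (1 - x ^ 2) + x * T' x) (hTK : 0 < T K) :
    1 / T K ≤ logSlope K := by
  rw [logSlope, div_le_div_iff₀ hTK (gaussMass_pos hK), one_mul]
  exact gaussMass_le_mul hT hK.le h

lemma logSlope_le_rational {K : ℝ} (hK : 0 < K) :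
    logSlope K ≤ 15 / (15 + 5 * K ^ 2 + K ^ 4) := by
  have hT : ∀ x : ℝ, HasDerivAt (fun x : ℝ => 1 + x ^ 2 / 3 + x ^ 4 / 15)
      (2 * x / 3 + 4 * x ^ 3 / 15) x := by
    intro x
    refine (((hasDerivAt_pow 2 x).div_const 3).const_add 1 |>.add
      ((hasDerivAt_pow 4 x).div_const 15)).congr_deriv ?_
    norm_num
  have h := logSlope_le hT (fun x hx => by
    have : 0 < x ^ 6 := by positivity
    nlinarith) hK (by positivity)
  refine h.trans_eq ?_
  have : 0 < 15 + 5 * K ^ 2 + K ^ 4 := by positivity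
  field_simp
  ring

lemma hasDerivAt_expSeries (x : ℝ) :
    HasDerivAt (fun x : ℝ => 1 + x ^ 2 / 3 + x ^ 4 / 15 + x ^ 6 / 105 + x ^ 8 / 945 + x ^ 10 / 10395)
      (2 * x / 3 + 4 * x ^ 3 / 15 + 6 * x ^ 5 / 105 + 8 * x ^ 7 / 945 + 10 * x ^ 9 / 10395) x := by
  refine (((((((hasDerivAt_pow 2 x).div_const 3).const_add 1).add
    ((hasDerivAt_pow 4 x).div_const 15)).add ((hasDerivAt_pow 6 x).div_const 105)).add
    ((hasDerivAt_pow 8 x).div_const 945)).add ((hasDerivAt_pow 10 x).div_const 10395)).congr_deriv ?_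
  norm_num

/-- Two-sided bounds from the expansion `1 / logSlope K = ∑ K ^ (2 n) / (2 n + 1)‼`; for the lower
bound the tail is absorbed in a term of order `12`, whose denominator `114345 = 11 * 11‼` works as
long as `K² ≤ 2`. -/
lemma logSlope_bounds : 0.5156 ≤ logSlope 1.37 ∧ logSlope 1.37 ≤ 0.5158 := by
  constructor
  · have h := le_logSlope (K := 1.37) (fun x => (hasDerivAt_expSeries x).add
      ((hasDerivAt_pow 12 x).div_const 114345)) (by norm_num) (fun x hx => by
        have h2 : x ^ 2 ≤ 2 := by nlinarith [hx.1, hx.2]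
        have h12 : 0 ≤ x ^ 12 := by positivity
        have : 0 ≤ x ^ 12 * (2 - x ^ 2) := mul_nonneg h12 (by linarith)
        norm_num
        nlinarith) (by norm_num)
    exact le_trans (by norm_num) h
  · have h := logSlope_le (K := 1.37) hasDerivAt_expSeries (fun x hx => by
      have : 0 ≤ x ^ 12 := by positivity
      nlinarith) (by norm_num) (by norm_num)
    exact h.trans (by norm_num)

lemma hasDerivAt_logSlope {K : ℝ} (hK : 0 < K) :
    HasDerivAt logSlope (-(logSlope K * (logSlope K + K ^ 2 - 1) / K)) K := by
  have hp := (gaussMass_pos hK).ne'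
  have h : HasDerivAt (fun x => 2 * x * gaussDensity x / gaussMass x) _ K :=
    (((hasDerivAt_id K).const_mul 2).mul (hasDerivAt_gaussDensity K)).div
      (hasDerivAt_gaussMass K) hp
  refine h.congr_deriv ?_
  simp [logSlope]
  field_simp
  ring

/-- The gap `-log p - log 2 * w²` with `w = logSlope K`. It is nonnegative if and only if
`2 log 2 K² ≤ π p² exp (K²) (-log p)`, because `w² = 2 K² exp (-K²) / (π p²)`. -/
noncomputable def rectGap (K : ℝ) : ℝ := -Real.log (gaussMass K) - Real.log 2 * logSlope K ^ 2

/-- The derivative has the sign of `log 2 * V - 1`, where `V = 2 w (w + K² - 1)` and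
`w = logSlope K`. -/
lemma hasDerivAt_rectGap {K : ℝ} (hK : 0 < K) :
    HasDerivAt rectGap (-(logSlope K / K *
      (1 - Real.log 2 * (2 * logSlope K * (logSlope K + K ^ 2 - 1))))) K := by
  have hp := (gaussMass_pos hK).ne'
  have h : HasDerivAt (fun x => -Real.log (gaussMass x) - Real.log 2 * logSlope x ^ 2) _ K :=
    ((hasDerivAt_gaussMass K).log hp).neg.sub (((hasDerivAt_logSlope hK).pow 2).const_mul _)
  refine h.congr_deriv ?_
  have e : 2 * gaussDensity K / gaussMass K = logSlope K / K := by
    rw [logSlope]; field_simp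
  rw [e]
  simp
  field_simp
  ring

/-- The function `V = 2 w (w + K² - 1)`, `w = logSlope K`, is monotone on `[1, 1.6]`. Its derivative
has the sign of `2 x - (w + x - 1) (2 w + x - 1)` with `x = K²`, which decreases in `w` when `1 ≤ x`,
so that the upper bound `logSlope_le_rational` reduces the claim to a polynomial in `y = x - 1`. -/
lemma monotone_slopeProduct {a b : ℝ} (ha : 1 ≤ a) (hab : a ≤ b) (hb : b ≤ 1.6) :
    2 * logSlope a * (logSlope a + a ^ 2 - 1) ≤ 2 * logSlope b * (logSlope b + b ^ 2 - 1) := by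
  have hd : ∀ x, 0 < x → HasDerivAt (fun x => 2 * logSlope x * (logSlope x + x ^ 2 - 1))
      (2 * logSlope x / x * (2 * x ^ 2 - (logSlope x + x ^ 2 - 1) * (2 * logSlope x + x ^ 2 - 1)))
      x := by
    intro x hx
    have h := hasDerivAt_logSlope hx
    refine ((h.const_mul 2).mul ((h.add (hasDerivAt_pow 2 x)).sub_const 1)).congr_deriv ?_
    simp
    field_simp
    ring
  refine le_of_hasDerivAt_nonneg hab
    (fun x hx => (hd x (by linarith [hx.1])).continuousAt.continuousWithinAt)
    (fun x hx => hd x (by linarith [hx.1])) fun x hx => ?_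
  have hx1 : 1 ≤ x := ha.trans hx.1.le
  have hx0 : 0 < x := by linarith
  have hx2 : x ≤ 1.6 := hx.2.le.trans hb
  have hw := logSlope_pos hx0
  have hwb := logSlope_le_rational hx0
  refine mul_nonneg (by positivity) ?_
  generalize logSlope x = w at hw hwb
  obtain ⟨y, hy⟩ : ∃ y, y = x ^ 2 - 1 := ⟨_, rfl⟩
  have hx4 : x ^ 4 = (y + 1) ^ 2 := by rw [hy]; ring
  have hxx : x ^ 2 = y + 1 := by rw [hy]; ring
  rw [hx4, hxx] at hwb
  rw [hxx]
  have hy0 : 0 ≤ y := by nlinarith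
  have hy1 : y ≤ 1.56 := by nlinarith
  set B := 15 + 5 * (y + 1) + (y + 1) ^ 2 with hB
  have hB0 : 0 < B := by positivity
  rw [le_div_iff₀ hB0] at hwb
  have hk : ∀ k : ℕ, y ^ (k + 1) ≤ 1.56 ^ k * y := fun k => by
    rw [pow_succ]
    exact mul_le_mul_of_nonneg_right (pow_le_pow_left₀ hy0 hy1 k) hy0
  have h3 := hk 2
  have h4 := hk 3
  have h5 := hk 4
  have h6 := hk 5
  norm_num at h3 h4 h5 h6
  have hwB0 : 0 < w * B := by positivity
  have key : 0 ≤ (2 * (y + 1) - y ^ 2) * B ^ 2 - 3 * (w * B) * y * B - 2 * (w * B) ^ 2 := by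
    have e : (2 * (y + 1) - y ^ 2) * B ^ 2 - 45 * y * B - 450 =
        432 + 525 * y + 14 * y ^ 2 - 129 * y ^ 3 - 61 * y ^ 4 - 12 * y ^ 5 - y ^ 6 := by
      rw [hB]; ring
    have h1 : (w * B) * (y * B) ≤ 15 * (y * B) :=
      mul_le_mul_of_nonneg_right hwb (by positivity)
    have h2 : (w * B) ^ 2 ≤ 15 ^ 2 := pow_le_pow_left₀ hwB0.le hwb 2
    nlinarith
  have e : (2 * (y + 1) - y ^ 2) * B ^ 2 - 3 * (w * B) * y * B - 2 * (w * B) ^ 2 =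
      (2 * (y + 1) - (w + (y + 1) - 1) * (2 * w + (y + 1) - 1)) * B ^ 2 := by ring
  rw [e] at key
  exact nonneg_of_mul_nonneg_left key (by positivity)

lemma log_two_mul_slopeProduct_le_one {K : ℝ} (hK : 0 < K) (hK1 : K ≤ 1.37) :
    Real.log 2 * (2 * logSlope K * (logSlope K + K ^ 2 - 1)) ≤ 1 := by
  have hl := Real.log_two_lt_d9
  have hl0 := Real.log_two_gt_d9
  have hw := logSlope_pos hK
  rcases le_or_gt K 1 with h | h
  · have hwb := logSlope_le_rational hK
    have hB : 0 < 15 + 5 * K ^ 2 + K ^ 4 := by positivity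
    have hK2 : K ^ 2 ≤ 1 := by nlinarith
    have hw1 : logSlope K ≤ 1 := hwb.trans (by rw [div_le_one hB]; nlinarith [sq_nonneg (K ^ 2)])
    have h1 : logSlope K * (logSlope K + K ^ 2 - 1) ≤ 15 / 21 := by
      calc logSlope K * (logSlope K + K ^ 2 - 1) ≤ logSlope K * K ^ 2 :=
            mul_le_mul_of_nonneg_left (by linarith) hw.le
        _ ≤ 15 / (15 + 5 * K ^ 2 + K ^ 4) * K ^ 2 :=
            mul_le_mul_of_nonneg_right hwb (sq_nonneg K)
        _ ≤ 15 / 21 := by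
            rw [div_mul_eq_mul_div, div_le_div_iff₀ hB (by norm_num)]
            nlinarith [sq_nonneg (K ^ 2 - 1)]
    nlinarith
  · have h1 := monotone_slopeProduct h.le hK1 (by norm_num)
    obtain ⟨-, h2⟩ := logSlope_bounds
    have h0 := logSlope_pos (K := 1.37) (by norm_num)
    have h3 : 2 * logSlope 1.37 * (logSlope 1.37 + 1.37 ^ 2 - 1) ≤ 1.437 := by nlinarith
    nlinarith

/-- The gap has a local minimum near `K = 1.378`, with a value close to `0.00283`; the point `1.37` is
chosen just to the left of it. -/
lemma rectGap_base : 0.002 ≤ rectGap 1.37 := by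
  obtain ⟨hw1, hw2⟩ := logSlope_bounds
  have hp := gaussMass_pos (K := 1.37) (by norm_num)
  have hpi := Real.pi_gt_d6
  have hexp : 6.53 ≤ Real.exp (1.37 ^ 2) := by
    have := Real.sum_le_exp_of_nonneg (x := 1.37 ^ 2) (by norm_num) 12
    refine le_trans ?_ this
    simp only [Finset.sum_range_succ, Finset.sum_range_zero, Nat.factorial]
    norm_num
  have hp2 : gaussMass 1.37 ^ 2 ≤ 0.6885 := by
    have e : (2 * 1.37 * gaussDensity 1.37) ^ 2 = (logSlope 1.37 * gaussMass 1.37) ^ 2 := by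
      rw [logSlope, div_mul_cancel₀ _ hp.ne']
    rw [mul_pow, gaussDensity_sq, Real.exp_neg, mul_pow (logSlope _)] at e
    have h1 : (Real.exp (1.37 ^ 2))⁻¹ / (2 * Real.pi) ≤ (6.53)⁻¹ / (2 * 3.141592) := by
      gcongr
    have h2 : (0.5156 : ℝ) ^ 2 ≤ logSlope 1.37 ^ 2 := by gcongr
    have h3 : (0.5156 : ℝ) ^ 2 * gaussMass 1.37 ^ 2 ≤ logSlope 1.37 ^ 2 * gaussMass 1.37 ^ 2 :=
      mul_le_mul_of_nonneg_right h2 (sq_nonneg _)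
    rw [← e] at h3
    have h4 := h3.trans (mul_le_mul_of_nonneg_left h1 (by norm_num))
    norm_num at h4 ⊢
    linarith
  have hlog : 2 * 0.1865 ≤ -Real.log (gaussMass 1.37 ^ 2) := by
    have h1 : -Real.log 0.6885 ≤ -Real.log (gaussMass 1.37 ^ 2) :=
      neg_le_neg (Real.log_le_log (by positivity) hp2)
    have h2 := sum_pow_div_le_neg_log (y := 0.3115) (by norm_num) (by norm_num) 6
    simp only [Finset.sum_range_succ, Finset.sum_range_zero] at h2
    norm_num at h2 h1 ⊢
    linarith
  rw [Real.log_pow] at hlog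
  have h5 : logSlope 1.37 ^ 2 ≤ 0.5158 ^ 2 := by
    have := logSlope_pos (K := 1.37) (by norm_num)
    gcongr
  have hl := Real.log_two_lt_d9
  have hl0 := Real.log_two_gt_d9
  rw [rectGap]
  push_cast at hlog
  nlinarith

lemma rectGap_nonneg_of_le {K : ℝ} (hK : 0 < K) (hK1 : K ≤ 1.37) : 0 ≤ rectGap K := by
  have h := le_of_hasDerivAt_nonneg (f := fun x => -rectGap x) hK1
    (fun x hx => (hasDerivAt_rectGap (hK.trans_le hx.1)).neg.continuousAt.continuousWithinAt)
    (fun x hx => (hasDerivAt_rectGap (hK.trans hx.1)).neg)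
    (fun x hx => by
      have hx0 := hK.trans hx.1
      have := log_two_mul_slopeProduct_le_one hx0 hx.2.le
      have := logSlope_pos hx0
      rw [neg_neg]
      exact mul_nonneg (by positivity) (by linarith))
  have := rectGap_base
  linarith

/-- To the right of `1.37` the gap decreases with slope at most `0.0036`, which on an interval of
length `0.23` cannot use up the value `0.002` at the left end. -/
lemma rectGap_nonneg_middle {K : ℝ} (hK : 1.37 ≤ K) (hK1 : K ≤ 1.6) : 0 ≤ rectGap K := by
  have h := le_of_hasDerivAt_nonneg (f := fun x => rectGap x + 0.0036 * x) hK
    (fun x hx => ((hasDerivAt_rectGap (by linarith [hx.1])).add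
      ((hasDerivAt_id x).const_mul 0.0036)).continuousAt.continuousWithinAt)
    (fun x hx => (hasDerivAt_rectGap (by linarith [hx.1])).add
      ((hasDerivAt_id x).const_mul 0.0036))
    (fun x hx => by
      have hx0 : 0 < x := by linarith [hx.1]
      have hw := logSlope_pos hx0
      have hwb := logSlope_le_rational hx0
      have hx1 := hx.1
      have hwx : logSlope x / x ≤ 0.4 := by
        rw [div_le_iff₀ hx0]
        refine hwb.trans ?_
        rw [div_le_iff₀ (by positivity)]
        have h2 : 1.8769 ≤ x ^ 2 := by nlinarith
        have h4 : 3.5 ≤ x ^ 4 := by nlinarith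
        nlinarith
      have hV : 1.43 ≤ 2 * logSlope x * (logSlope x + x ^ 2 - 1) := by
        refine le_trans ?_ (monotone_slopeProduct (by norm_num) hx1.le (hx.2.le.trans hK1))
        obtain ⟨h1, -⟩ := logSlope_bounds
        nlinarith
      have hl0 := Real.log_two_gt_d9
      have hV2 : 0.991 ≤ Real.log 2 * (2 * logSlope x * (logSlope x + x ^ 2 - 1)) := by nlinarith
      have hq : 0 < logSlope x / x := by positivity
      nlinarith)
  have := rectGap_base
  linarith

/-- For `1.6 ≤ K` the logarithm is expanded to second order in `P = 1 - p`. With `P / 2 ≥ φ r` from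
`mills_lower`, it suffices that `r (1 - 3 φ r) ≥ 2 log 2 K² φ`; writing `r = K ρ` and `a = K φ`, that
is `a (2 log 2 + 3 ρ²) ≤ ρ`. In terms of `u = K² - 1.6²` this follows from a polynomial inequality all
of whose coefficients are positive. -/
lemma rectGap_nonneg_tail {K : ℝ} (hK : 1.6 ≤ K) : 0 ≤ rectGap K := by
  have hK0 : 0 < K := by linarith
  obtain ⟨u, hu⟩ : ∃ u, u = K ^ 2 - 2.56 := ⟨_, rfl⟩
  have hu0 : 0 ≤ u := by nlinarith
  have hx : K ^ 2 = u + 2.56 := by rw [hu]; ring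
  have hg := gaussDensity_pos K
  have hbase : gaussDensity 1.6 ≤ 0.111 := by
    have hexp : 12.93 ≤ Real.exp (1.6 ^ 2) := by
      have := Real.sum_le_exp_of_nonneg (x := 1.6 ^ 2) (by norm_num) 14
      refine le_trans ?_ this
      simp only [Finset.sum_range_succ, Finset.sum_range_zero, Nat.factorial]
      norm_num
    have hpi := Real.pi_gt_d6
    refine (pow_le_pow_iff_left₀ (gaussDensity_pos _).le (by norm_num) two_ne_zero).1 ?_
    rw [gaussDensity_sq, Real.exp_neg]
    calc (Real.exp (1.6 ^ 2))⁻¹ / (2 * Real.pi) ≤ (12.93)⁻¹ / (2 * 3.141592) := by gcongr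
      _ ≤ _ := by norm_num
  have hgK : gaussDensity K * (1 + u / 2 + u ^ 2 / 8) ≤ 0.111 := by
    have e : gaussDensity K = gaussDensity 1.6 * (Real.exp (u / 2))⁻¹ := by
      rw [gaussDensity, gaussDensity, mul_assoc, ← Real.exp_neg, ← Real.exp_add]
      congr 2
      rw [hu]; ring
    have hq := Real.quadratic_le_exp_of_nonneg (x := u / 2) (by positivity)
    have hE := Real.exp_pos (u / 2)
    calc gaussDensity K * (1 + u / 2 + u ^ 2 / 8) ≤ gaussDensity K * Real.exp (u / 2) :=
          mul_le_mul_of_nonneg_left (by nlinarith) hg.le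
      _ = gaussDensity 1.6 := by rw [e, mul_assoc, inv_mul_cancel₀ hE.ne', mul_one]
      _ ≤ _ := hbase
  have hKu : K ≤ 1.6 * (1 + u / 5.12) := by
    have := sq_nonneg (K - 1.6)
    rw [hu]
    ring_nf at this ⊢
    linarith
  set a := K * gaussDensity K with ha
  have ha0 : 0 < a := by positivity
  have hau : a * (1 + u / 2 + u ^ 2 / 8) ≤ 0.1776 * (1 + u / 5.12) := by
    calc a * (1 + u / 2 + u ^ 2 / 8) = K * (gaussDensity K * (1 + u / 2 + u ^ 2 / 8)) := by
          rw [ha]; ring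
      _ ≤ (1.6 * (1 + u / 5.12)) * 0.111 :=
          mul_le_mul hKu hgK (by positivity) (by positivity)
      _ = 0.1776 * (1 + u / 5.12) := by ring
  set q := K ^ 4 + 6 * K ^ 2 + 3 with hq
  have hq0 : 0 < q := by positivity
  set ρ := (K ^ 2 + 5) / q with hρ
  have hρ0 : 0 < ρ := by positivity
  have hl := Real.log_two_lt_d9
  have hl0 := Real.log_two_gt_d9
  have hmain : a * (2 * Real.log 2 + 3 * ρ ^ 2) ≤ ρ := by
    have h1 : a * (1.3863 + 3 * ρ ^ 2) ≤ ρ := by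
      have hpoly : 0.1776 * (1 + u / 5.12) * (1.3863 * q ^ 2 + 3 * (K ^ 2 + 5) ^ 2) ≤
          (K ^ 2 + 5) * q * (1 + u / 2 + u ^ 2 / 8) := by
        have hqu : q = (u + 2.56) ^ 2 + 6 * (u + 2.56) + 3 := by rw [hq, ← hx]; ring
        rw [hqu, hx, ← sub_nonneg]
        ring_nf
        positivity
      have h2 : a * (1.3863 * q ^ 2 + 3 * (K ^ 2 + 5) ^ 2) * (1 + u / 2 + u ^ 2 / 8) ≤
          (K ^ 2 + 5) * q * (1 + u / 2 + u ^ 2 / 8) := by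
        refine le_trans ?_ hpoly
        calc _ = a * (1 + u / 2 + u ^ 2 / 8) * (1.3863 * q ^ 2 + 3 * (K ^ 2 + 5) ^ 2) := by ring
          _ ≤ _ := mul_le_mul_of_nonneg_right hau (by positivity)
      have h3 := le_of_mul_le_mul_right h2 (by positivity)
      have e1 : a * (1.3863 + 3 * ρ ^ 2) = a * (1.3863 * q ^ 2 + 3 * (K ^ 2 + 5) ^ 2) / q ^ 2 := by
        rw [hρ]; field_simp
      have e2 : ρ = (K ^ 2 + 5) * q / q ^ 2 := by rw [hρ]; field_simp
      rw [e1, e2]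
      gcongr
    refine le_trans (mul_le_mul_of_nonneg_left ?_ ha0.le) h1
    linarith
  set P := 1 - gaussMass K with hP
  have hPm : 2 * (a * ρ) ≤ P := by
    have := mills_lower K
    rw [← hP, ← hq] at this
    refine le_trans (le_of_eq ?_) this
    rw [ha, hρ]; ring
  have hP3 : P ≤ 1 / 3 := by
    have := mills_upper hK0
    rw [← hP] at this
    have hD : gaussDensity K ≤ 0.111 := by
      refine le_trans ?_ hgK
      nlinarith [mul_nonneg hg.le hu0, mul_nonneg hg.le (sq_nonneg u)]
    nlinarith
  have haρ : 0 < a * ρ := by positivity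
  have hquad : 2 * (a * ρ) * (1 - 3 * (a * ρ)) ≤ P * (1 - 3 / 2 * P) := by nlinarith
  have hlow : 4 * Real.log 2 * a ^ 2 ≤ 2 * (a * ρ) * (1 - 3 * (a * ρ)) := by
    have := mul_le_mul_of_nonneg_left hmain ha0.le
    nlinarith
  have hP0 : 0 < P := by linarith
  have hprod : 4 * Real.log 2 * a ^ 2 ≤ (P + P ^ 2 / 2) * (1 - P) ^ 2 := by
    have e : (P + P ^ 2 / 2) * (1 - P) ^ 2 = P * (1 - 3 / 2 * P) + P ^ 4 / 2 := by ring
    have : 0 ≤ P ^ 4 := by positivity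
    rw [e]
    linarith
  have hlog : P + P ^ 2 / 2 ≤ -Real.log (gaussMass K) := by
    have h2 := sum_pow_div_le_neg_log (y := P) hP0.le (by linarith) 2
    simp only [Finset.sum_range_succ, Finset.sum_range_zero] at h2
    have e : 1 - P = gaussMass K := by rw [hP]; ring
    rw [e] at h2
    norm_num at h2
    linarith
  have hGm := gaussMass_pos hK0
  have hw : Real.log 2 * logSlope K ^ 2 ≤ P + P ^ 2 / 2 := by
    have e : Real.log 2 * logSlope K ^ 2 = 4 * Real.log 2 * a ^ 2 / gaussMass K ^ 2 := by
      rw [logSlope, ha]; ring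
    rw [e, div_le_iff₀ (by positivity)]
    have e : gaussMass K = 1 - P := by rw [hP]; ring
    rw [e]
    exact hprod
  rw [rectGap]
  linarith

/-- The rectangle function needs no restriction on `K`: the first moment threshold always lies below
the threshold at which `F''(1/2)` changes sign. -/
lemma rectThreshold {K : ℝ} (hK : 0 < K) :
    2 * Real.log 2 * K ^ 2 ≤
      Real.pi * pRect K ^ 2 * Real.exp (K ^ 2) * (-Real.log (pRect K)) := by
  have h : 0 ≤ rectGap K := by
    rcases le_or_gt K 1.37 with h | h
    · exact rectGap_nonneg_of_le hK h
    · rcases le_or_gt K 1.6 with h' | h'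
      · exact rectGap_nonneg_middle h.le h'
      · exact rectGap_nonneg_tail h'.le
  have hp := gaussMass_pos hK
  have hpi := Real.pi_pos
  rw [pRect_eq_gaussMass hK.le]
  rw [rectGap, logSlope, div_pow, mul_pow, gaussDensity_sq, Real.exp_neg, sub_nonneg] at h
  calc 2 * Real.log 2 * K ^ 2 = Real.pi * gaussMass K ^ 2 * Real.exp (K ^ 2) *
        (Real.log 2 * ((2 * K) ^ 2 * ((Real.exp (K ^ 2))⁻¹ / (2 * Real.pi)) / gaussMass K ^ 2)) := by
        field_simp
    _ ≤ _ := mul_le_mul_of_nonneg_left h (by positivity)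

/-! ### The maximum of the exponent and the conclusion -/

lemma qDeriv_half (K : ℝ) : qDeriv K (1 / 2) = 0 := by
  rw [qDeriv, show (1 : ℝ) - 1 / 2 = 1 / 2 by norm_num, sub_self, zero_div]

lemma qDeriv_nonneg {K β : ℝ} (h : 1 / 2 ≤ β) (h1 : β < 1) : 0 ≤ qDeriv K β := by
  have hpi := Real.pi_pos
  refine div_nonneg (sub_nonneg.2 (Real.exp_le_exp.2 (neg_le_neg ?_))) (by positivity)
  exact div_le_div_of_nonneg_left (sq_nonneg K) (by linarith) (by linarith)

lemma hasDerivAt_qDeriv_half (K : ℝ) :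
    HasDerivAt (qDeriv K) (8 * K ^ 2 * Real.exp (-K ^ 2) / Real.pi) (1 / 2) := by
  have hpi := Real.pi_pos
  have h1 : HasDerivAt (fun β : ℝ => Real.exp (-(K ^ 2 / (2 * β))))
      (2 * K ^ 2 * Real.exp (-K ^ 2)) (1 / 2) := by
    refine ((((hasDerivAt_id (1 / 2 : ℝ)).const_mul 2).fun_inv
      (by norm_num)).const_mul (K ^ 2)).neg.exp.congr_deriv ?_
    norm_num
    ring
  have h2 : HasDerivAt (fun β : ℝ => Real.exp (-(K ^ 2 / (2 * (1 - β)))))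
      (-(2 * K ^ 2 * Real.exp (-K ^ 2))) (1 / 2) := by
    have e : (1 : ℝ) - 1 / 2 = 1 / 2 := by norm_num
    have := HasDerivAt.comp_const_sub (f := fun β : ℝ => Real.exp (-(K ^ 2 / (2 * β)))) 1 (1 / 2)
      (by rw [e]; exact h1)
    exact this
  have h3 : HasDerivAt (fun β : ℝ => Real.pi * (√β * √(1 - β)))
      (deriv (fun β : ℝ => Real.pi * (√β * √(1 - β))) (1 / 2)) (1 / 2) := by
    refine DifferentiableAt.hasDerivAt ?_
    refine ((differentiableAt_id.sqrt (by norm_num)).mul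
      ((differentiableAt_id.const_sub 1).sqrt (by norm_num))).const_mul _
  have hden : Real.pi * (√(1 / 2 : ℝ) * √(1 - 1 / 2)) = Real.pi / 2 := by
    rw [show (1 : ℝ) - 1 / 2 = 1 / 2 by norm_num, Real.mul_self_sqrt (by norm_num)]
    ring
  refine ((h1.sub h2).div h3 (by rw [hden]; positivity)).congr_deriv ?_
  rw [hden]
  have e : (1 : ℝ) - 1 / 2 = 1 / 2 := by norm_num
  simp only [Pi.sub_apply, e, sub_self, zero_mul, sub_zero]
  field_simp
  ring

/-- Let `b` be the only zero of `F'` in `(1/2, 1)`. By Darboux's theorem `F'` has constant sign on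
`(1/2, b)` and on `(b, 1)`; the first sign is negative because `F''(1/2) < 0`. Whatever the second
sign is, `F` is at most the larger of `F b` and `F 1` on `[b, 1]`. -/
lemma lt_at_half_of_numericalHypothesis {F F' : ℝ → ℝ} (hc : ContinuousOn F (Set.Icc 0 1))
    (hd : ∀ β ∈ Set.Ioo (0 : ℝ) 1, HasDerivAt F (F' β) β) (hF' : F' (1 / 2) = 0) {A : ℝ}
    (hA : HasDerivAt F' A (1 / 2)) (hA0 : A < 0) (hH : NumericalHypothesis F)
    (hone : F 1 < F (1 / 2)) {β : ℝ} (h1 : 1 / 2 < β) (h2 : β ≤ 1) : F β < F (1 / 2) := by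
  have hderiv : ∀ β ∈ Set.Ioo (0 : ℝ) 1, deriv F β = F' β := fun β hβ => (hd β hβ).deriv
  have hev : deriv F =ᶠ[nhds (1 / 2)] F' := by
    filter_upwards [Ioo_mem_nhds (by norm_num : (0 : ℝ) < 1 / 2) (by norm_num : (1 / 2 : ℝ) < 1)]
      with b hb using hderiv b hb
  have h2d : deriv (deriv F) (1 / 2) < 0 := by
    rw [hev.deriv_eq, hA.deriv]; exact hA0
  obtain ⟨b, ⟨hb, hb0⟩, huniq⟩ := hH h2d
  have hsign : ∀ s : Set ℝ, Convex ℝ s → s ⊆ Set.Ioo (1 / 2) 1 → b ∉ s →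
      (∀ x ∈ s, F' x < 0) ∨ ∀ x ∈ s, 0 < F' x := by
    intro s hs hsub hbs
    refine hasDerivWithinAt_forall_lt_or_forall_gt_of_forall_ne hs
      (fun x hx => (hd x ⟨by linarith [(hsub hx).1], (hsub hx).2⟩).hasDerivWithinAt) ?_
    intro x hx h0
    have := huniq x ⟨hsub hx, by
      rw [hderiv x ⟨by linarith [(hsub hx).1], (hsub hx).2⟩]; exact h0⟩
    exact hbs (this ▸ hx)
  have hneg : ∀ᶠ x in nhdsWithin (1 / 2 : ℝ) (Set.Ioi (1 / 2)), F' x < 0 := by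
    have hs := (hasDerivAt_iff_tendsto_slope.1 hA).mono_left
      (nhdsWithin_mono _ fun x (hx : 1 / 2 < x) => hx.ne')
    filter_upwards [hs.eventually (gt_mem_nhds hA0), self_mem_nhdsWithin] with x hx hx'
    have hx'' : 0 < x - 1 / 2 := sub_pos.2 hx'
    rw [slope_def_field, hF', sub_zero, div_neg_iff] at hx
    rcases hx with h | h
    · linarith [h.2]
    · exact h.1
  have hleft : ∀ x ∈ Set.Ioo (1 / 2) b, F' x < 0 := by
    rcases hsign _ (convex_Ioo (1 / 2) b) (Set.Ioo_subset_Ioo_right hb.2.le)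
      (fun h => lt_irrefl _ h.2) with h | h
    · exact h
    · exfalso
      obtain ⟨x, hx1, hx2⟩ := (hneg.and (Ioo_mem_nhdsGT hb.1)).exists
      exact lt_asymm hx1 (h x hx2)
  have hanti : StrictAntiOn F (Set.Icc (1 / 2) b) := by
    refine strictAntiOn_of_deriv_neg (convex_Icc _ _)
      (hc.mono (Set.Icc_subset_Icc (by norm_num) hb.2.le)) ?_
    rw [interior_Icc]
    intro x hx
    rw [hderiv x ⟨by linarith [hx.1], hx.2.trans hb.2⟩]
    exact hleft x hx
  have hFb : F b < F (1 / 2) :=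
    hanti (Set.left_mem_Icc.2 hb.1.le) (Set.right_mem_Icc.2 hb.1.le) hb.1
  rcases le_or_gt β b with h | h
  · exact hanti (Set.left_mem_Icc.2 hb.1.le) ⟨h1.le, h⟩ h1
  · have hcb : ContinuousOn F (Set.Icc b 1) :=
      hc.mono (Set.Icc_subset_Icc (by linarith [hb.1]) le_rfl)
    rcases hsign _ (convex_Ioo b 1) (Set.Ioo_subset_Ioo_left hb.1.le)
      (fun h => lt_irrefl _ h.1) with hs | hs
    · refine lt_of_le_of_lt ?_ hFb
      refine (strictAntiOn_of_deriv_neg (convex_Icc b 1) hcb ?_).antitoneOn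
        (Set.left_mem_Icc.2 hb.2.le) ⟨h.le, h2⟩ h.le
      rw [interior_Icc]
      intro x hx
      rw [hderiv x ⟨by linarith [hx.1, hb.1], hx.2⟩]
      exact hs x hx
    · refine lt_of_le_of_lt ?_ hone
      refine (strictMonoOn_of_deriv_pos (convex_Icc b 1) hcb ?_).monotoneOn
        ⟨h.le, h2⟩ (Set.right_mem_Icc.2 hb.2.le) h2
      rw [interior_Icc]
      intro x hx
      rw [hderiv x ⟨by linarith [hx.1, hb.1], hx.2⟩]
      exact hs x hx

/-- A one-sided quadratic upper bound from the second derivative. -/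
lemma exists_le_quadratic {g g' : ℝ → ℝ} (hd : ∀ β ∈ Set.Ioo (0 : ℝ) 1, HasDerivAt g (g' β) β)
    (hg : g (1 / 2) = 0) (hg' : g' (1 / 2) = 0) {A c : ℝ} (hA : HasDerivAt g' A (1 / 2))
    (hAc : A < 2 * c) :
    ∃ ε > 0, ∀ β ∈ Set.Icc (1 / 2) (1 / 2 + ε), g β ≤ c * (β - 1 / 2) ^ 2 := by
  have hslope : ∀ᶠ x in nhdsWithin (1 / 2 : ℝ) (Set.Ioi (1 / 2)), g' x ≤ 2 * c * (x - 1 / 2) := by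
    have hs := (hasDerivAt_iff_tendsto_slope.1 hA).mono_left
      (nhdsWithin_mono _ fun x (hx : 1 / 2 < x) => hx.ne')
    filter_upwards [hs.eventually (gt_mem_nhds hAc), self_mem_nhdsWithin] with x hx hx'
    have hx'' : 0 < x - 1 / 2 := sub_pos.2 hx'
    rw [slope_def_field, hg', sub_zero, div_lt_iff₀ hx''] at hx
    exact hx.le
  obtain ⟨δ, hδ, hsub⟩ := mem_nhdsGT_iff_exists_Ioo_subset.1 hslope
  have hδ' : 1 / 2 < δ := hδ
  refine ⟨min (δ - 1 / 2) (1 / 4), lt_min (by linarith) (by norm_num), fun β hβ => ?_⟩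
  have hβ1 : β ≤ δ := by linarith [hβ.2, min_le_left (δ - 1 / 2) (1 / 4)]
  have hβ2 : β ≤ 3 / 4 := by linarith [hβ.2, min_le_right (δ - 1 / 2) (1 / 4)]
  have hdd : ∀ x ∈ Set.Icc (1 / 2) β, HasDerivAt (fun x => c * (x - 1 / 2) ^ 2 - g x)
      (2 * c * (x - 1 / 2) - g' x) x := by
    intro x hx
    refine (((((hasDerivAt_id x).sub_const (1 / 2)).pow 2).const_mul c).sub
      (hd x ⟨by linarith [hx.1], by linarith [hx.2]⟩)).congr_deriv ?_
    simp; ring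
  have := le_of_hasDerivAt_nonneg hβ.1
    (fun x hx => (hdd x hx).continuousAt.continuousWithinAt)
    (fun x hx => hdd x (Set.Ioo_subset_Icc_self hx))
    (fun x hx => sub_nonneg.2 (hsub ⟨hx.1, hx.2.trans_le hβ1⟩))
  simp only [hg, sub_self] at this
  linarith

/-- The second moment is at most a constant times the square of the first moment. The hypothesis
`hthr` places the first moment threshold for `α` at or below the value at which `F''(1/2) = 0`, and
`hαp` says both that `α` is below this threshold and that `F 1 < F (1/2)`. -/
lemma exists_secondMoment_bound {K α p : ℝ} {q : ℝ → ℝ} (hα : 0 < α)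
    (hp0 : 0 < p) (hp1 : p < 1) (hqc : ContinuousOn q (Set.Icc 0 1))
    (hqd : ∀ β ∈ Set.Ioo (0 : ℝ) 1, HasDerivAt q (qDeriv K β) β)
    (hhalf : q (1 / 2) = p ^ 2) (hone : q 1 = p) (hsymm : ∀ β, q (1 - β) = q β)
    (hthr : 2 * Real.log 2 * K ^ 2 ≤ Real.pi * p ^ 2 * Real.exp (K ^ 2) * (-Real.log p))
    (hαp : α < -Real.log 2 / Real.log p)
    (hH : NumericalHypothesis fun β => Real.binEntropy β + α * Real.log (q β)) :
    ∃ C : ℝ, 0 < C ∧ ∀ N : ℕ, N ≠ 0 →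
      ∑ l ∈ Finset.range (N + 1), N.choose l * q ((l : ℝ) / N) ^ ⌊α * N⌋₊ ≤
        C * 2 ^ N * (p ^ 2) ^ ⌊α * N⌋₊ := by
  have hpi := Real.pi_pos
  have hP : 0 < p ^ 2 := by positivity
  have hlogp : Real.log p < 0 := Real.log_neg hp0 hp1
  have hα' : α * (-Real.log p) < Real.log 2 := by
    rw [lt_div_iff_of_neg hlogp] at hαp
    linarith
  have hl2 : 0 < Real.log 2 := Real.log_pos one_lt_two
  have hq' : ∀ β ∈ Set.Icc (1 / 2 : ℝ) 1, p ^ 2 ≤ q β := by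
    intro β hβ
    rw [← hhalf]
    exact le_of_hasDerivAt_nonneg hβ.1
      (hqc.mono (Set.Icc_subset_Icc (by norm_num) hβ.2))
      (fun x hx => hqd x ⟨by linarith [hx.1], by linarith [hx.2, hβ.2]⟩)
      (fun x hx => qDeriv_nonneg hx.1.le (by linarith [hx.2, hβ.2]))
  have hq : ∀ β ∈ Set.Icc (0 : ℝ) 1, p ^ 2 ≤ q β := by
    intro β hβ
    rcases le_total (1 / 2) β with h | h
    · exact hq' β ⟨h, hβ.2⟩
    · rw [← hsymm]
      exact hq' _ ⟨by linarith, by linarith [hβ.1]⟩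
  have hq0 : ∀ β ∈ Set.Icc (0 : ℝ) 1, 0 < q β := fun β hβ => hP.trans_le (hq β hβ)
  have hmem : (1 / 2 : ℝ) ∈ Set.Ioo (0 : ℝ) 1 := by norm_num
  set ψ : ℝ → ℝ := fun β => α * Real.log (q β / p ^ 2) with hψ
  set ψ' : ℝ → ℝ := fun β => α * (qDeriv K β / q β) with hψ'
  have hψeq : ∀ β ∈ Set.Icc (0 : ℝ) 1, ψ β = α * Real.log (q β) - α * Real.log (p ^ 2) := by
    intro β hβ
    simp only [hψ]
    rw [Real.log_div (hq0 β hβ).ne' hP.ne']; ring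
  have hlogd : ∀ β ∈ Set.Ioo (0 : ℝ) 1, HasDerivAt (fun β => α * Real.log (q β)) (ψ' β) β :=
    fun β hβ => ((hqd β hβ).log (hq0 β (Set.Ioo_subset_Icc_self hβ)).ne').const_mul α
  have hψd : ∀ β ∈ Set.Ioo (0 : ℝ) 1, HasDerivAt ψ (ψ' β) β := by
    intro β hβ
    refine ((hlogd β hβ).sub_const (α * Real.log (p ^ 2))).congr_of_eventuallyEq ?_
    filter_upwards [Ioo_mem_nhds hβ.1 hβ.2] with b hb
      using hψeq b (Set.Ioo_subset_Icc_self hb)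
  -- `F''(1/2) = -4 + A`
  set A : ℝ := α * (8 * K ^ 2 * Real.exp (-K ^ 2) / Real.pi / p ^ 2) with hA
  have hA0 : 0 ≤ A := by positivity
  have hψ'd : HasDerivAt ψ' A (1 / 2) := by
    refine (((hasDerivAt_qDeriv_half K).div (hqd _ hmem)
      (hq0 _ (Set.Ioo_subset_Icc_self hmem)).ne').const_mul α).congr_deriv ?_
    rw [qDeriv_half, hhalf, hA]
    field_simp
    ring
  have hψ'half : ψ' (1 / 2) = 0 := by simp only [hψ', qDeriv_half, zero_div, mul_zero]
  have hA4 : A < 4 := by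
    have hE := Real.exp_pos (K ^ 2)
    have h1 : A * (Real.pi * p ^ 2 * Real.exp (K ^ 2)) = α * (8 * K ^ 2) := by
      rw [hA, Real.exp_neg]; field_simp
    have hD : 0 < Real.pi * p ^ 2 * Real.exp (K ^ 2) := by positivity
    set D := Real.pi * p ^ 2 * Real.exp (K ^ 2) with hDdef
    have h2 : α * (8 * K ^ 2) * Real.log 2 < 4 * D * Real.log 2 := by
      calc α * (8 * K ^ 2) * Real.log 2 = 4 * α * (2 * Real.log 2 * K ^ 2) := by ring
        _ ≤ 4 * α * (D * (-Real.log p)) := mul_le_mul_of_nonneg_left hthr (by positivity)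
        _ = 4 * D * (α * (-Real.log p)) := by ring
        _ < 4 * D * Real.log 2 := mul_lt_mul_of_pos_left hα' (by positivity)
    have h3 := lt_of_mul_lt_mul_right h2 hl2.le
    rw [← h1] at h3
    exact lt_of_mul_lt_mul_right h3 hD.le
  obtain ⟨ε, hε, hnear⟩ := exists_le_quadratic (c := (A + 4) / 4) hψd
    (by simp only [hψ, hhalf, div_self hP.ne', Real.log_one, mul_zero]) hψ'half hψ'd (by linarith)
  set F : ℝ → ℝ := fun β => Real.binEntropy β + α * Real.log (q β) with hF
  set F' : ℝ → ℝ := fun β => Real.log (1 - β) - Real.log β + ψ' β with hF'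
  have hFc : ContinuousOn F (Set.Icc 0 1) :=
    Real.binEntropy_continuous.continuousOn.add
      (continuousOn_const.mul (hqc.log fun β hβ => (hq0 β hβ).ne'))
  have hFd : ∀ β ∈ Set.Ioo (0 : ℝ) 1, HasDerivAt F (F' β) β := fun β hβ =>
    (Real.hasDerivAt_binEntropy hβ.1.ne' hβ.2.ne).add (hlogd β hβ)
  have hF'd : HasDerivAt F' (-4 + A) (1 / 2) := by
    have h1 : HasDerivAt (fun β : ℝ => Real.log (1 - β)) (-2) (1 / 2) := by
      refine (((hasDerivAt_id (1 / 2 : ℝ)).const_sub 1).log (by norm_num)).congr_deriv ?_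
      norm_num
    refine ((h1.sub (Real.hasDerivAt_log (by norm_num))).add hψ'd).congr_deriv ?_
    norm_num
  have hF'half : F' (1 / 2) = 0 := by
    simp only [hF', hψ'half]; norm_num
  have hFhalf : F (1 / 2) = Real.log 2 + α * Real.log (p ^ 2) := by
    simp only [hF, hhalf]
    rw [show (1 / 2 : ℝ) = 2⁻¹ by norm_num, Real.binEntropy_two_inv]
  have hFone : F 1 < F (1 / 2) := by
    rw [hFhalf]
    simp only [hF, hone, Real.binEntropy_one, Real.log_pow]
    push_cast
    linarith
  have hlt : ∀ β, 1 / 2 < β → β ≤ 1 → F β < F (1 / 2) := fun β h1 h2 =>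
    lt_at_half_of_numericalHypothesis hFc hFd hF'half hF'd (by linarith) hH hFone h1 h2
  obtain ⟨η, hη, hfar⟩ : ∃ η > 0, ∀ β ∈ Set.Icc (1 / 2 + ε) 1, F β ≤ F (1 / 2) - η := by
    rcases (Set.Icc (1 / 2 + ε) 1).eq_empty_or_nonempty with he | hne
    · exact ⟨1, one_pos, fun β hβ => by rw [he] at hβ; exact absurd hβ (Set.notMem_empty _)⟩
    · obtain ⟨b, hb, hmax⟩ := isCompact_Icc.exists_isMaxOn hne
        (hFc.mono (Set.Icc_subset_Icc (by linarith) le_rfl))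
      refine ⟨F (1 / 2) - F b, sub_pos.2 (hlt b (by linarith [hb.1]) hb.2), fun β hβ => ?_⟩
      have : F β ≤ F b := hmax hβ
      linarith
  refine exists_sum_choose_mul_pow_le (ε := ε) (c := (A + 4) / 4) (η := η) hα hP (by linarith)
    (by linarith) hη hq ?_ ?_
  · intro β hβ hβε
    rw [abs_le] at hβε
    rcases le_total (1 / 2) β with h | h
    · exact hnear β ⟨h, by linarith [hβε.2]⟩
    · have := hnear (1 - β) ⟨by linarith, by linarith [hβε.1]⟩
      simp only [hψ, hsymm] at this
      refine this.trans_eq ?_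
      ring
  · have key : ∀ β ∈ Set.Icc (1 / 2 + ε) 1,
        Real.binEntropy β + α * Real.log (q β / p ^ 2) ≤ Real.log 2 - η := by
      intro β hβ
      have h1 := hfar β hβ
      have h2 := hψeq β ⟨by linarith [hβ.1], hβ.2⟩
      simp only [hψ] at h2
      rw [hFhalf] at h1
      simp only [hF] at h1
      rw [h2]
      linarith
    intro β hβ hβε
    rcases lt_abs.1 hβε with h | h
    · exact key β ⟨by linarith, hβ.2⟩
    · have := key (1 - β) ⟨by linarith, by linarith [hβ.1]⟩
      rwa [Real.binEntropy_one_sub, hsymm] at this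

lemma liminf_pos_of_secondMoment_bound {S : Set ℝ} (hS : MeasurableSet S) {α p C : ℝ} (hp : 0 < p)
    (hpS : (gaussianReal 0 1).real S = p) (hC : 0 < C)
    (hbound : ∀ N : ℕ, N ≠ 0 →
      ∑ l ∈ Finset.range (N + 1), N.choose l * pairProb S ((l : ℝ) / N) ^ ⌊α * N⌋₊ ≤
        C * 2 ^ N * (p ^ 2) ^ ⌊α * N⌋₊) :
    0 < liminf (fun N : ℕ => patternLaw ⌊α * N⌋₊ N
      {X | 1 ≤ partitionFunction (S.indicator 1) X}) atTop := by
  refine lt_of_lt_of_le (ENNReal.ofReal_pos.2 (inv_pos.2 hC)) (le_liminf_of_le (by isBoundedDefault)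
    ?_)
  filter_upwards [eventually_ne_atTop 0] with N hN
  have : IsProbabilityMeasure (patternLaw ⌊α * N⌋₊ N) := by unfold patternLaw; infer_instance
  have h1 := sq_firstMoment_le hN ⌊α * N⌋₊ hS
  rw [hpS] at h1
  set m := (patternLaw ⌊α * N⌋₊ N).real {X | 1 ≤ partitionFunction (S.indicator 1) X} with hm
  have hm0 : 0 ≤ m := measureReal_nonneg
  have h2 : (2 ^ N * p ^ ⌊α * N⌋₊) ^ 2 ≤ (2 ^ N * p ^ ⌊α * N⌋₊) ^ 2 * (C * m) := by
    refine h1.trans ?_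
    calc _ ≤ (2 ^ N * (C * 2 ^ N * (p ^ 2) ^ ⌊α * N⌋₊)) * m := by
          gcongr
          exact hbound N hN
      _ = _ := by ring
  have h3 : 1 ≤ C * m := by
    have hpos : 0 < (2 ^ N * p ^ ⌊α * N⌋₊) ^ 2 := by positivity
    refine le_of_mul_le_mul_left ?_ hpos
    rwa [mul_one]
  refine ENNReal.ofReal_le_of_le_toReal ?_
  rw [← measureReal_def, ← hm, inv_le_iff_one_le_mul₀' hC]
  exact h3

lemma qRect_half (K : ℝ) : qRect K (1 / 2) = pRect K ^ 2 :=
  pairProb_half (S := {z : ℝ | |z| ≤ K}) (measurableSet_le (by fun_prop) (by fun_prop))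

lemma qU_half (K : ℝ) : qU K (1 / 2) = pU K ^ 2 :=
  pairProb_half (S := {z : ℝ | K ≤ |z|}) (measurableSet_le (by fun_prop) (by fun_prop))

end BinaryPerceptron

open BinaryPerceptron in
theorem proposition2 (K α : ℝ) (hK : 0 < K) (hα : 0 < α) :
    (NumericalHypothesis (FRect K α) →
      α < -Real.log 2 / Real.log (pRect K) →
        0 < liminf (fun N : ℕ => patternLaw ⌊α * N⌋₊ N (rectEvent K N ⌊α * N⌋₊)) atTop) ∧
    (∀ Kstar : ℝ, IsKStar Kstar →
      NumericalHypothesis (FU K α) →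
        K < Kstar →
          α < -Real.log 2 / Real.log (pU K) →
            0 < liminf (fun N : ℕ => patternLaw ⌊α * N⌋₊ N (uEvent K N ⌊α * N⌋₊)) atTop) := by
  have hr : pRect K = gaussMass K := pRect_eq_gaussMass hK.le
  have hr0 : 0 < pRect K := hr ▸ gaussMass_pos hK
  have hr1 : pRect K < 1 := hr ▸ gaussMass_lt_one K
  have hmr : MeasurableSet {z : ℝ | |z| ≤ K} := measurableSet_le (by fun_prop) (by fun_prop)
  have hmu : MeasurableSet {z : ℝ | K ≤ |z|} := measurableSet_le (by fun_prop) (by fun_prop)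
  constructor
  · intro hH hαp
    obtain ⟨C, hC, hbound⟩ := exists_secondMoment_bound (q := qRect K) hα hr0 hr1
      (continuousOn_qRect hK) (fun β hβ => hasDerivAt_qRect hK hβ.1 hβ.2) (qRect_half K)
      (pairProb_one {z : ℝ | |z| ≤ K}) (pairProb_one_sub hmr (by simp)) (rectThreshold hK) hαp hH
    exact liminf_pos_of_secondMoment_bound hmr hr0 rfl hC hbound
  · intro Kstar hs hH hlt hαp
    have hu := pU_eq K
    obtain ⟨C, hC, hbound⟩ := exists_secondMoment_bound (q := qU K) hα
      (by linarith : 0 < pU K) (by linarith)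
      (((continuousOn_qRect hK).const_add (1 - 2 * pRect K)).congr
        fun β hβ => qU_eq hβ.1 hβ.2)
      (fun β hβ => ((hasDerivAt_qRect hK hβ.1 hβ.2).const_add
        (1 - 2 * pRect K)).congr_of_eventuallyEq (by
          filter_upwards [Ioo_mem_nhds hβ.1 hβ.2] with b hb using qU_eq hb.1.le hb.2.le))
      (qU_half K) (pairProb_one {z : ℝ | K ≤ |z|}) (pairProb_one_sub hmu (by simp))
      (uThreshold hK hs hlt) hαp hH
    exact liminf_pos_of_secondMoment_bound hmu (by linarith : 0 < pU K) rfl hC hbound
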